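/- Let $n$ be a natural number and let $a_1,\dots,a_n$ be positive real numbers with $\sum_{i=1}^n e^{-a_i}=1$. For real $z$ let $S(z)=\{\mathbf{x}\in\mathbb{R}^n : x_i\ge 0 \text{ for all } i,\ \sum_{i=1}^n a_i x_i\le z\}$. For $\mathbf{x}\in\mathbb{R}^n$ with nonnegative components put $$M(\mathbf{x})=\frac{\Gamma(x_1+\dots+x_n+1)}{\Gamma(x_1+1)\cdots\Gamma(x_n+1)},$$ so that $M(\mathbf{k})=\frac{(k_1+\dots+k_n)!}{k_1!\cdots k_n!}$ is the multinomial coefficient when $\mathbf{k}$ is a vector of nonnegative integers. Let $$f(z)=\int_{S(z)}M(\mathbf{x})\,d\mathbf{x},\qquad \tilde Q(z)=\sum_{\mathbf{k}\in S(z)\cap\mathbb{Z}^n}M(\mathbf{k}).$$ If at least one of the ratios $a_i/a_k$ with $i,k\in\{1,\dots,n\}$, $i\ne k$, is irrational, then $$\lim_{z\to\infty}\frac{f(z)}{\tilde Q(z)}=1.$$ -/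

import Mathlib

namespace PascalPyramid

/-- The simplex `S(z) = {x : x ≥ 0, a₁ x₁ + ⋯ + aₙ xₙ ≤ z}` in `ℝⁿ`. -/
def simplex {n : ℕ} (a : Fin n → ℝ) (z : ℝ) : Set (Fin n → ℝ) :=
  {x | (∀ i, 0 ≤ x i) ∧ ∑ i, a i * x i ≤ z}

/-- The multinomial coefficient of a real vector, every factorial `t!` being read as `Γ(t + 1)`. -/
noncomputable def realMultinomial {n : ℕ} (x : Fin n → ℝ) : ℝ :=
  Real.Gamma (∑ i, x i + 1) / ∏ i, Real.Gamma (x i + 1)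

/-- The integral of the multinomial coefficient over `S(z)`, for Lebesgue measure on `ℝⁿ`. -/
noncomputable def simplexIntegral {n : ℕ} (a : Fin n → ℝ) (z : ℝ) : ℝ :=
  ∫ x in simplex a z, realMultinomial x

/-- The integer vectors in `S(z)`; they are nonnegative, hence vectors of natural numbers. -/
def latticePoints {n : ℕ} (a : Fin n → ℝ) (z : ℝ) : Set (Fin n → ℕ) :=
  {k | (fun i => (k i : ℝ)) ∈ simplex a z}

/-- The sum of the multinomial coefficients `(k₁ + ⋯ + kₙ)! / (k₁! ⋯ kₙ!)` over the integer
vectors in `S(z)`. The sum is finite when all `aᵢ` are positive, see `latticePoints_finite`. -/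
noncomputable def latticeSum {n : ℕ} (a : Fin n → ℝ) (z : ℝ) : ℝ :=
  ∑ᶠ k ∈ latticePoints a z, (Nat.multinomial Finset.univ k : ℝ)

theorem latticePoints_finite {n : ℕ} (a : Fin n → ℝ) (ha : ∀ i, 0 < a i) (z : ℝ) :
    (latticePoints a z).Finite := by
  refine (Set.finite_Iic (fun i => ⌊z / a i⌋₊)).subset ?_
  rintro k ⟨h0, hk⟩ i
  refine Nat.le_floor ?_
  rw [le_div_iff₀ (ha i), mul_comm]
  refine le_trans ?_ hk
  exact Finset.single_le_sum (f := fun i => a i * (k i : ℝ))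
    (fun j _ => mul_nonneg (ha j).le (h0 j)) (Finset.mem_univ i)

/-- At integer vectors `realMultinomial` is the usual multinomial coefficient. -/
theorem realMultinomial_natCast {n : ℕ} (k : Fin n → ℕ) :
    realMultinomial (fun i => (k i : ℝ)) = (Nat.multinomial Finset.univ k : ℝ) := by
  have h := Nat.multinomial_spec Finset.univ k
  have h1 : ∏ i, ((k i).factorial : ℝ) ≠ 0 :=
    Finset.prod_ne_zero_iff.mpr fun i _ => by positivity
  have h2 : Real.Gamma (∑ i, (k i : ℝ) + 1) = ((∑ i, k i).factorial : ℝ) := by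
    rw [← Real.Gamma_nat_eq_factorial]
    push_cast
    rfl
  unfold realMultinomial
  rw [h2]
  simp only [Real.Gamma_nat_eq_factorial]
  rw [div_eq_iff h1, ← h]
  push_cast
  ring

end PascalPyramid

/-! Put pᵢ = e^{-aᵢ}, a probability vector. Pascal's recurrence M(x) = ∑ M(x - eᵢ) turns both e^{-z}
Q̃(z) and e^{-z} f(z) into solutions of a renewal equation g(z) = h(z) + ∑ pᵢ g(z - aᵢ). The renewal
theorem `tendsto_of_renewal_equation` gives each the limit ∫h / ∑ pᵢ aᵢ, so the claim reduces to the
two forcing terms having equal mass. Both masses are 1.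

For Q̃ only the origin lacks predecessors, so h = e^{-z} on z ≥ 0. For f the recurrence loses the
predecessors with xᵢ < 1, and h(z) = e^{-z} ∫_{S(z)} `boundaryDensity`. By Tonelli its mass is ∫
`boundaryDensity`(x) e^{-a·x} dx over x ≥ 0. Poissonization (`pascalTerm_eq_lintegral`) writes the
integrand as a mixture over t > 0 of products of gamma densities at pⱼt. Integrating out x, with xᵢ
in (0,1) and the other coordinates in (0,∞), leaves ∑ᵢ pᵢ v(pᵢt) ∏_{j≠i} V(pⱼt), where v is
`meanDensity` and V = ∫₀ v is `meanCDF`. This is the derivative of ∏ V(pⱼt), which rises from 0 to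
1.

The renewal theorem rests on a Choquet–Deny argument: a bounded Lipschitz harmonic function of the
walk is constant when two steps are incommensurable. Hence every ultrafilter limit of the increments
of G = ∫g is linear with a forced slope, and monotonicity of e^z g passes from G back to g. -/

open Filter Topology MeasureTheory Set
open scoped ENNReal

/-! ### Bounded harmonic functions of the walk -/

/-- A bounded real family converges along every ultrafilter. -/
theorem Ultrafilter.exists_tendsto_of_abs_le {α : Type*} (l : Ultrafilter α) {u : α → ℝ} {B : ℝ}
    (hu : ∀ x, |u x| ≤ B) : ∃ c, Tendsto u l (𝓝 c) := by
  have hmem : ∀ᶠ x in l, u x ∈ Icc (-B) B := Eventually.of_forall fun x => abs_le.mp (hu x)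
  obtain ⟨c, -, hc⟩ := isCompact_Icc.ultrafilter_le_nhds' (l.map u) hmem
  exact ⟨c, hc⟩

/-- `D` is bounded, Lipschitz and harmonic for the random walk with steps `-aᵢ` taken with
weights `pᵢ`. -/
structure BoundedHarmonic {ι : Type*} [Fintype ι] (p a : ι → ℝ) (D : ℝ → ℝ) : Prop where
  bounded : ∃ B, ∀ x, |D x| ≤ B
  lipschitz : ∃ K, ∀ x y, |D x - D y| ≤ K * |x - y|
  mean : ∀ x, D x = ∑ i, p i * D (x - a i)

namespace BoundedHarmonic

variable {ι : Type*} [Fintype ι] {p a : ι → ℝ} {D : ℝ → ℝ}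

theorem shift_sub (hD : BoundedHarmonic p a D) (t : ℝ) :
    BoundedHarmonic p a (fun x => D (x + t) - D x) := by
  obtain ⟨⟨B, hB⟩, ⟨K, hK⟩, hm⟩ := hD
  refine ⟨⟨B + B, fun x => (abs_sub _ _).trans (add_le_add (hB _) (hB _))⟩,
    ⟨K + K, fun x y => ?_⟩, fun x => ?_⟩
  · have h1 := hK (x + t) (y + t)
    have h2 := hK x y
    rw [add_sub_add_right_eq_sub] at h1
    calc |D (x + t) - D x - (D (y + t) - D y)| = |(D (x + t) - D (y + t)) - (D x - D y)| := by
          ring_nf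
      _ ≤ _ := abs_sub _ _
      _ ≤ _ := by linarith
  · rw [hm x, hm (x + t), ← Finset.sum_sub_distrib]
    exact Finset.sum_congr rfl fun i _ => by ring_nf

theorem continuous (hD : BoundedHarmonic p a D) : Continuous D := by
  obtain ⟨K, hK⟩ := hD.lipschitz
  refine (LipschitzWith.of_dist_le_mul (K := K.toNNReal) fun x y => ?_).continuous
  rw [Real.dist_eq, Real.dist_eq]
  exact (hK x y).trans (mul_le_mul_of_nonneg_right (Real.le_coe_toNNReal K) (abs_nonneg _))

/-- Along an ultrafilter the translates converge at all points at once, with no extraction of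
subsequences; the bounds and the mean-value identity survive pointwise limits. -/
theorem exists_translate_limit {α : Type*} (hD : BoundedHarmonic p a D) (l : Ultrafilter α)
    (y : α → ℝ) :
    ∃ D', BoundedHarmonic p a D' ∧ ∀ x, Tendsto (fun s => D (x + y s)) l (𝓝 (D' x)) := by
  obtain ⟨⟨B, hB⟩, ⟨K, hK⟩, hm⟩ := hD
  choose D' hD' using fun x : ℝ => l.exists_tendsto_of_abs_le (fun s => hB (x + y s))
  refine ⟨D', ⟨⟨B, fun x => ?_⟩, ⟨K, fun x x' => ?_⟩, fun x => ?_⟩, hD'⟩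
  · exact le_of_tendsto (hD' x).abs (Eventually.of_forall fun s => hB _)
  · refine le_of_tendsto ((hD' x).sub (hD' x')).abs (Eventually.of_forall fun s => ?_)
    simpa using hK (x + y s) (x' + y s)
  · refine tendsto_nhds_unique (hD' x) ?_
    have := tendsto_finsetSum Finset.univ fun i _ => (hD' (x - a i)).const_mul (p i)
    refine this.congr fun s => ?_
    rw [hm]
    exact Finset.sum_congr rfl fun i _ => by ring_nf

/-- Maximum principle: an average with positive weights reaches an upper bound only if every
averaged value does. -/
theorem eq_max_sub (hp : ∀ i, 0 < p i) (hp1 : ∑ i, p i = 1) (hD : BoundedHarmonic p a D) {η : ℝ}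
    (hle : ∀ x, D x ≤ η) {x : ℝ} (hx : D x = η) (i : ι) : D (x - a i) = η := by
  have h : ∑ j, p j * (η - D (x - a j)) = 0 := by
    simp only [mul_sub, Finset.sum_sub_distrib, ← Finset.sum_mul, hp1]
    rw [← hD.mean, hx]
    ring
  rw [Finset.sum_eq_zero_iff_of_nonneg
    fun j _ => mul_nonneg (hp j).le (sub_nonneg.mpr (hle _))] at h
  have := (mul_eq_zero.mp (h i (Finset.mem_univ i))).resolve_left (hp i).ne'
  linarith

theorem eq_max_sub_nat (hp : ∀ i, 0 < p i) (hp1 : ∑ i, p i = 1) (hD : BoundedHarmonic p a D)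
    {η : ℝ} (hle : ∀ x, D x ≤ η) {x : ℝ} (hx : D x = η) (i : ι) (m : ℕ) :
    D (x - m * a i) = η := by
  induction m with
  | zero => simpa using hx
  | succ m ih =>
    have := hD.eq_max_sub hp hp1 hle ih i
    rw [← this]
    push_cast
    ring_nf

/-- The increments `D (x + t) - D x` are nonpositive: translates along which they approach a
positive supremum would converge to an unbounded function. -/
theorem shift_le (hp : ∀ i, 0 < p i) (hp1 : ∑ i, p i = 1)
    {i k : ι} (hirr : Irrational (a i / a k)) (hD : BoundedHarmonic p a D) (t x : ℝ) :
    D (x + t) ≤ D x := by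
  by_contra! hx
  set E : ℝ → ℝ := fun y => D (y + t) - D y with hE
  have hEx : 0 < E x := by simp only [hE]; linarith
  have hbdd : BddAbove (range E) := by
    obtain ⟨B, hB⟩ := (hD.shift_sub t).bounded
    exact ⟨B, by rintro _ ⟨y, rfl⟩; exact (abs_le.mp (hB y)).2⟩
  set η := sSup (range E) with hη
  have hηpos : 0 < η := hEx.trans_le (le_csSup hbdd ⟨x, rfl⟩)
  have hEle : ∀ y, E y ≤ η := fun y => le_csSup hbdd ⟨y, rfl⟩
  obtain ⟨u, -, hu, hu'⟩ := exists_seq_tendsto_sSup (range_nonempty E) hbdd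
  choose y hy using hu'
  let l : Ultrafilter ℕ := Ultrafilter.of atTop
  have hl : (l : Filter ℕ) ≤ atTop := Ultrafilter.of_le atTop
  -- After recentring at near-maximizers, the increment of the limit `D₁` attains η at 0; the
  -- maximum principle then spreads the value η over the semigroup of backward steps.
  obtain ⟨D₁, hD₁, hlim₁⟩ := hD.exists_translate_limit l y
  have hE₁lim : ∀ x, Tendsto (fun s => E (x + y s)) l (𝓝 (D₁ (x + t) - D₁ x)) := fun x => by
    refine ((hlim₁ (x + t)).sub (hlim₁ x)).congr fun s => ?_
    simp only [hE]
    ring_nf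
  have hE₁le : ∀ x, D₁ (x + t) - D₁ x ≤ η := fun x =>
    le_of_tendsto (hE₁lim x) (Eventually.of_forall fun s => hEle _)
  have hE₁0 : D₁ (0 + t) - D₁ 0 = η := by
    refine tendsto_nhds_unique (hE₁lim 0) ?_
    simp only [zero_add, hy]
    exact hu.mono_left hl
  have hE₁ := hD₁.shift_sub t
  have hsemi : ∀ m₁ m₂ : ℕ, D₁ ((0 - m₁ * a i - m₂ * a k) + t) - D₁ (0 - m₁ * a i - m₂ * a k) = η :=
    fun m₁ m₂ => hE₁.eq_max_sub_nat hp hp1 hE₁le (hE₁.eq_max_sub_nat hp hp1 hE₁le hE₁0 i m₁) k m₂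
  -- Translating ever further back turns the semigroup into the whole group: c aᵢ + d aₖ - s(aᵢ +
  -- aₖ) is a backward position as soon as s ≥ c and s ≥ d.
  obtain ⟨D₂, hD₂, hlim₂⟩ := hD₁.exists_translate_limit l (fun s => -(s * (a i + a k)))
  have hE₂ := hD₂.shift_sub t
  have hdense : Dense (AddSubgroup.closure {a i, a k} : Set ℝ) :=
    dense_addSubgroupClosure_pair_iff.mpr hirr
  have hgroup : ∀ x ∈ (AddSubgroup.closure {a i, a k} : Set ℝ), D₂ (x + t) - D₂ x = η := by
    intro x hx
    obtain ⟨c, d, rfl⟩ := AddSubgroup.mem_closure_pair.mp hx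
    refine tendsto_nhds_unique ((hlim₂ _).sub (hlim₂ _)) ?_
    refine tendsto_const_nhds.congr' ?_
    filter_upwards [hl (eventually_ge_atTop (c.natAbs + d.natAbs))] with s hs
    have h1 : (((s - c).toNat : ℕ) : ℝ) = s - c := by
      have : (((s - c).toNat : ℤ)) = s - c := Int.toNat_of_nonneg (by omega)
      exact_mod_cast this
    have h2 : (((s - d).toNat : ℕ) : ℝ) = s - d := by
      have : (((s - d).toNat : ℤ)) = s - d := Int.toNat_of_nonneg (by omega)
      exact_mod_cast this
    rw [← hsemi (s - c).toNat (s - d).toNat, h1, h2]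
    simp only [zsmul_eq_mul]
    ring_nf
  have hall : ∀ x, D₂ (x + t) - D₂ x = η := by
    have := Continuous.ext_on hdense hE₂.continuous continuous_const hgroup
    exact fun x => congrFun this x
  -- An increment equal to η > 0 everywhere forces linear growth, against boundedness of `D₂`.
  have hiter : ∀ m : ℕ, D₂ (m * t) = D₂ 0 + m * η := by
    intro m
    induction m with
    | zero => simp
    | succ m ih =>
      have := hall (m * t)
      push_cast
      rw [add_mul, one_mul]
      linarith
  obtain ⟨B, hB⟩ := hD₂.bounded
  obtain ⟨m, hm⟩ := exists_nat_gt ((B + B) / η)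
  rw [div_lt_iff₀ hηpos] at hm
  have h1 := abs_le.mp (hB (m * t))
  have h2 := abs_le.mp (hB 0)
  have := hiter m
  linarith [h1.2, h2.1]

/-- A bounded Lipschitz harmonic function is constant when two of the steps are
incommensurable. -/
theorem eq_of_irrational (hp : ∀ i, 0 < p i) (hp1 : ∑ i, p i = 1)
    {i k : ι} (hirr : Irrational (a i / a k)) (hD : BoundedHarmonic p a D) (x y : ℝ) :
    D x = D y := by
  have h := hD.shift_le hp hp1 hirr
  refine le_antisymm ?_ ?_
  · simpa using h (x - y) y
  · simpa using h (y - x) x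

end BoundedHarmonic

/-! ### The renewal theorem -/

/-- A Lipschitz function whose weighted increments `∑ pᵢ (L x - L (x - aᵢ))` are constant is
linear. -/
theorem eq_mul_of_weighted_increments_const {ι : Type*} [Fintype ι] {p a : ι → ℝ}
    (hp : ∀ i, 0 < p i) (hp1 : ∑ i, p i = 1) {i k : ι} (hirr : Irrational (a i / a k))
    {L : ℝ → ℝ} {B m : ℝ} (hL0 : L 0 = 0) (hlip : ∀ x y, |L x - L y| ≤ B * |x - y|)
    (hL : ∀ x, ∑ i, p i * (L x - L (x - a i)) = m) (x : ℝ) :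
    (∑ i, p i * a i) * L x = m * x := by
  have hmean : ∀ x, L x = m + ∑ i, p i * L (x - a i) := fun x => by
    rw [← hL x]
    simp only [mul_sub, Finset.sum_sub_distrib, ← Finset.sum_mul, hp1]
    ring
  -- The constant m cancels in differences, and the Lipschitz bound on `L` makes the differences
  -- bounded.
  have hharm : ∀ t, BoundedHarmonic p a (fun x => L (x + t) - L x) := fun t => by
    refine ⟨⟨B * |t|, fun x => by simpa using hlip (x + t) x⟩, ⟨B + B, fun x y => ?_⟩,
      fun x => ?_⟩
    · have h1 := hlip (x + t) (y + t)
      have h2 := hlip x y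
      rw [add_sub_add_right_eq_sub] at h1
      calc |L (x + t) - L x - (L (y + t) - L y)| = |(L (x + t) - L (y + t)) - (L x - L y)| := by
            ring_nf
        _ ≤ _ := abs_sub _ _
        _ ≤ _ := by linarith
    · rw [hmean x, hmean (x + t), add_sub_add_left_eq_sub, ← Finset.sum_sub_distrib]
      exact Finset.sum_congr rfl fun i _ => by ring_nf
  -- Constancy of the increment in x, compared with its value at 0, is Cauchy's equation.
  have hadd : ∀ x t, L (x + t) = L x + L t := fun x t => by
    have := (hharm t).eq_of_irrational hp hp1 hirr x 0
    simp only [zero_add, hL0] at this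
    linarith
  have hcont : Continuous L := by
    refine (LipschitzWith.of_dist_le_mul (K := B.toNNReal) fun x y => ?_).continuous
    rw [Real.dist_eq, Real.dist_eq]
    exact (hlip x y).trans (mul_le_mul_of_nonneg_right (Real.le_coe_toNNReal B) (abs_nonneg _))
  let A : ℝ →+ ℝ := ⟨⟨L, hL0⟩, hadd⟩
  have hlin : ∀ x, L x = x * L 1 := fun x => by
    have : A (x • 1) = x • A 1 := (A.toRealLinearMap hcont).map_smul x 1
    rwa [smul_eq_mul, mul_one] at this
  have h := hL 0
  have h' : ∑ i, p i * (L 0 - L (0 - a i)) = (∑ i, p i * a i) * L 1 := by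
    rw [Finset.sum_mul]
    refine Finset.sum_congr rfl fun i _ => ?_
    rw [hlin (0 - a i), hL0]
    ring
  rw [hlin x, ← h, h']
  ring

/-- **Renewal theorem** for a walk with finitely many positive steps, two of them
incommensurable: a solution `g` of `g z = h z + ∑ pᵢ g (z - aᵢ)` that vanishes on the negative axis
and becomes monotone when multiplied by `exp` tends to `∫ h / ∑ pᵢ aᵢ`. -/
theorem tendsto_of_renewal_equation {ι : Type*} [Fintype ι] {p a : ι → ℝ}
    (hp : ∀ i, 0 < p i) (hp1 : ∑ i, p i = 1) (ha : ∀ i, 0 < a i)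
    {i k : ι} (hirr : Irrational (a i / a k)) {g h : ℝ → ℝ}
    (hmono : Monotone fun z => Real.exp z * g z) (hg0 : ∀ z < 0, g z = 0)
    (hgh : ∀ z, g z = h z + ∑ i, p i * g (z - a i)) (hh : Integrable h) :
    Tendsto g atTop (𝓝 ((∫ z, h z) / ∑ i, p i * a i)) := by
  have hcmp : ∀ x y, x ≤ y → Real.exp (-(y - x)) * g x ≤ g y := fun x y hxy => by
    have := mul_le_mul_of_nonneg_left (hmono hxy) (Real.exp_pos (-y)).le
    simp only [← mul_assoc, ← Real.exp_add] at this
    simpa [neg_sub, sub_eq_neg_add] using this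
  have hg : ∀ z, 0 ≤ g z := fun z => by
    have := hcmp (min z (-1)) z (min_le_left _ _)
    rwa [hg0 _ ((min_le_right _ _).trans_lt (by norm_num)), mul_zero] at this
  have hint : ∀ x y, IntervalIntegrable g volume x y := fun x y => by
    have h1 : IntervalIntegrable (fun z => Real.exp (-z) * (Real.exp z * g z)) volume x y :=
      hmono.intervalIntegrable.continuousOn_mul
        (Real.continuous_exp.comp continuous_neg).continuousOn
    simpa [← mul_assoc, ← Real.exp_add] using h1
  set G : ℝ → ℝ := fun z => ∫ t in (0 : ℝ)..z, g t with hG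
  have hGsub : ∀ x y, G y - G x = ∫ t in x..y, g t := fun x y =>
    intervalIntegral.integral_interval_sub_left (hint _ _) (hint _ _)
  have hGneg : ∀ x ≤ 0, G x = 0 := fun x hx => by
    refine intervalIntegral.integral_zero_ae ?_
    filter_upwards [Measure.ae_ne volume (0 : ℝ)] with t ht htx
    rw [uIoc_of_ge hx] at htx
    exact hg0 t (lt_of_le_of_ne htx.2 ht)
  -- The renewal equation integrated from 0 to x; since ∑ pᵢ = 1 it becomes a statement about
  -- increments of `G`.
  have hconv : ∀ x, ∑ i, p i * (G x - G (x - a i)) = ∫ t in (0 : ℝ)..x, h t := fun x => by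
    have h1 : ∫ t in (0 : ℝ)..x, h t = G x - ∑ i, p i * G (x - a i) := by
      have h2 : ∀ i, ∫ t in (0 : ℝ)..x, g (t - a i) = G (x - a i) := fun i => by
        rw [intervalIntegral.integral_comp_sub_right, ← hGsub, hGneg (0 - a i) (by linarith [ha i]),
          sub_zero]
      have h3 : ∀ i, IntervalIntegrable (fun t => p i * g (t - a i)) volume 0 x := fun i => by
        have := ((hint (0 - a i) (x - a i)).comp_sub_right (a i)).const_mul (p i)
        simpa using this
      have h4 : h = fun t => g t - ∑ i, p i * g (t - a i) := by
        funext t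
        rw [hgh t]
        ring
      have h5 : IntervalIntegrable (fun t => ∑ i, p i * g (t - a i)) volume 0 x := by
        simpa only [Finset.sum_fn] using IntervalIntegrable.sum Finset.univ fun i _ => h3 i
      rw [h4, intervalIntegral.integral_sub (hint _ _) h5,
        intervalIntegral.integral_finsetSum fun i _ => h3 i]
      simp only [intervalIntegral.integral_const_mul, h2, hG]
    rw [h1]
    simp only [mul_sub, Finset.sum_sub_distrib, ← Finset.sum_mul, hp1]
    ring
  have hlower : ∀ x y, x ≤ y → (y - x) * (Real.exp (-(y - x)) * g x) ≤ G y - G x :=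
    fun x y hxy => by
      rw [hGsub, ← smul_eq_mul, ← intervalIntegral.integral_const]
      refine intervalIntegral.integral_mono_on hxy intervalIntegrable_const (hint _ _)
        fun t ht => le_trans ?_ (hcmp x t ht.1)
      exact mul_le_mul_of_nonneg_right (Real.exp_le_exp.mpr (by linarith [ht.2])) (hg x)
  have hupper : ∀ x y, x ≤ y → Real.exp (-(y - x)) * (G y - G x) ≤ (y - x) * g y :=
    fun x y hxy => by
      rw [hGsub, ← smul_eq_mul (y - x), ← intervalIntegral.integral_const,
        ← intervalIntegral.integral_const_mul]
      refine intervalIntegral.integral_mono_on hxy ((hint _ _).const_mul _)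
        intervalIntegrable_const fun t ht => le_trans ?_ (hcmp t y ht.2)
      exact mul_le_mul_of_nonneg_right (Real.exp_le_exp.mpr (by linarith [ht.1])) (hg t)
  have hGmono : Monotone G := fun x y hxy => by
    have h1 := hlower x y hxy
    have h2 : 0 ≤ (y - x) * (Real.exp (-(y - x)) * g x) :=
      mul_nonneg (by linarith) (mul_nonneg (Real.exp_pos _).le (hg x))
    linarith
  have hHle : ∀ x, 0 ≤ x → ∫ t in (0 : ℝ)..x, h t ≤ ∫ t, ‖h t‖ := fun x hx => by
    refine (le_abs_self _).trans ((intervalIntegral.abs_integral_le_integral_abs hx).trans ?_)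
    rw [intervalIntegral.integral_of_le hx]
    exact setIntegral_le_integral hh.norm (Eventually.of_forall fun t => abs_nonneg _)
  -- Since g cannot decay faster than e^{-t}, pᵢ aᵢ e^{-aᵢ} g(z) ≤ pᵢ (G(z + aᵢ) - G(z)). This is
  -- one nonnegative term of the integrated equation at z + aᵢ, whose total is at most ‖h‖₁.
  obtain ⟨B, hB⟩ : ∃ B, ∀ z, g z ≤ B := by
    refine ⟨(∫ t, ‖h t‖) / (p i * (a i * Real.exp (-a i))), fun z => ?_⟩
    have hpos : 0 < p i * (a i * Real.exp (-a i)) :=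
      mul_pos (hp i) (mul_pos (ha i) (Real.exp_pos _))
    rw [le_div_iff₀ hpos]
    rcases lt_or_ge z 0 with hz | hz
    · rw [hg0 z hz, zero_mul]
      exact integral_nonneg fun t => norm_nonneg _
    · have h1 := hlower z (z + a i) (by linarith [ha i])
      have h2 : p i * (G (z + a i) - G z) ≤ ∑ j, p j * (G (z + a i) - G (z + a i - a j)) := by
        have := Finset.single_le_sum
          (f := fun j => p j * (G (z + a i) - G (z + a i - a j)))
          (fun j _ => mul_nonneg (hp j).le (sub_nonneg.mpr (hGmono (by linarith [ha j]))))
          (Finset.mem_univ i)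
        simpa using this
      rw [hconv] at h2
      have h3 := hHle (z + a i) (by linarith [ha i])
      have h4 := mul_le_mul_of_nonneg_left h1 (hp i).le
      simp only [add_sub_cancel_left] at h4
      linarith
  have hGlip : ∀ x y, |G x - G y| ≤ B * |x - y| := fun x y => by
    rw [hGsub, ← Real.norm_eq_abs]
    refine intervalIntegral.norm_integral_le_of_norm_le_const fun t _ => ?_
    rw [Real.norm_of_nonneg (hg t)]
    exact hB t
  have hHlim : Tendsto (fun x => ∫ t in (0 : ℝ)..x, h t) atTop (𝓝 (∫ z, h z)) := by
    have h1 : ∫ z, h z = ∫ z in Ioi 0, h z := by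
      rw [← integral_Ici_eq_integral_Ioi]
      refine (setIntegral_eq_integral_of_forall_compl_eq_zero fun z hz => ?_).symm
      rw [mem_Ici, not_le] at hz
      have := hgh z
      rw [hg0 z hz, Finset.sum_eq_zero fun j _ => by
        rw [hg0 _ (by linarith [ha j]), mul_zero]] at this
      linarith
    rw [h1]
    exact intervalIntegral_tendsto_integral_Ioi 0 hh.integrableOn tendsto_id
  set m := ∫ z, h z with hm
  have hμ : 0 < ∑ i, p i * a i := Finset.sum_pos (fun i _ => mul_pos (hp i) (ha i)) ⟨i, by simp⟩
  set c := m / ∑ i, p i * a i with hc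
  -- It suffices to identify the limit along each ultrafilter finer than `atTop`. There the limiting
  -- increments have weighted increments constantly m, hence are linear with slope c, whichever
  -- ultrafilter was taken.
  have hincr : ∀ x, Tendsto (fun z => G (z + x) - G z) atTop (𝓝 (c * x)) := fun x₀ => by
    rw [tendsto_iff_ultrafilter]
    intro l hl
    choose L hL using fun x : ℝ => l.exists_tendsto_of_abs_le (u := fun z => G (z + x) - G z)
      (B := B * |x|) (fun z => by simpa using hGlip (z + x) z)
    have hL0 : L 0 = 0 := tendsto_nhds_unique (hL 0) (by simp)
    have hLlip : ∀ x y, |L x - L y| ≤ B * |x - y| := fun x y => by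
      refine le_of_tendsto ((hL x).sub (hL y)).abs (Eventually.of_forall fun z => ?_)
      simpa using hGlip (z + x) (z + y)
    have hLm : ∀ x, ∑ i, p i * (L x - L (x - a i)) = m := fun x => by
      refine tendsto_nhds_unique (tendsto_finsetSum Finset.univ fun i _ =>
        ((hL x).sub (hL (x - a i))).const_mul (p i)) ?_
      refine ((hHlim.comp (tendsto_atTop_add_const_right _ x tendsto_id)).mono_left hl).congr
        fun z => ?_
      rw [Function.comp, ← hconv]
      refine Finset.sum_congr rfl fun j _ => ?_
      simp only [id]
      ring_nf
    have h1 := eq_mul_of_weighted_increments_const hp hp1 hirr hL0 hLlip hLm x₀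
    have h2 : c * x₀ = L x₀ := by
      rw [hc]
      field_simp
      linarith
    rw [h2]
    exact hL x₀
  -- Tauberian step: e^{-δ} (G(z) - G(z - δ))/δ ≤ g(z) ≤ e^{δ} (G(z + δ) - G(z))/δ. The outer terms
  -- tend to e^{∓δ} c as z → ∞, and δ is taken small enough for the given y.
  refine tendsto_order.mpr ⟨fun y hy => ?_, fun y hy => ?_⟩
  · have h1 : Tendsto (fun δ : ℝ => Real.exp (-δ) * c) (𝓝[>] 0) (𝓝 c) := by
      have : Continuous fun δ : ℝ => Real.exp (-δ) * c := by fun_prop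
      simpa using (this.tendsto 0).mono_left nhdsWithin_le_nhds
    obtain ⟨δ, hδy, hδ⟩ := ((h1.eventually_const_lt hy).and self_mem_nhdsWithin).exists
    have hδ : 0 < δ := hδ
    have h2 : Tendsto (fun z => Real.exp (-δ) * (G (z - δ + δ) - G (z - δ)) / δ) atTop
        (𝓝 (Real.exp (-δ) * (c * δ) / δ)) :=
      (((hincr δ).comp (tendsto_atTop_add_const_right _ (-δ) tendsto_id)).const_mul _).div_const _
    have h3 : Real.exp (-δ) * (c * δ) / δ = Real.exp (-δ) * c := by field_simp
    rw [h3] at h2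
    filter_upwards [h2.eventually_const_lt hδy] with z hz
    refine hz.trans_le ?_
    rw [div_le_iff₀ hδ]
    have := hupper (z - δ) (z - δ + δ) (by linarith)
    simp only [add_sub_cancel_left] at this
    rw [sub_add_cancel] at this ⊢
    linarith
  · have h1 : Tendsto (fun δ : ℝ => c * Real.exp δ) (𝓝[>] 0) (𝓝 c) := by
      have : Continuous fun δ : ℝ => c * Real.exp δ := by fun_prop
      simpa using (this.tendsto 0).mono_left nhdsWithin_le_nhds
    obtain ⟨δ, hδy, hδ⟩ := ((h1.eventually_lt_const hy).and self_mem_nhdsWithin).exists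
    have hδ : 0 < δ := hδ
    have h2 := ((hincr δ).div_const δ).mul_const (Real.exp δ)
    have h3 : c * δ / δ = c := by field_simp
    rw [h3] at h2
    filter_upwards [h2.eventually_lt_const hδy] with z hz
    refine lt_of_le_of_lt ?_ hz
    have := hlower z (z + δ) (by linarith)
    simp only [add_sub_cancel_left] at this
    rw [Real.exp_neg] at this
    rw [div_mul_eq_mul_div, le_div_iff₀ hδ]
    have h4 := mul_le_mul_of_nonneg_right this (Real.exp_pos δ).le
    have h5 := (Real.exp_pos δ).ne'
    field_simp at h4
    linarith

/-! ### Pascal's recurrence and the lattice sum -/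

namespace PascalPyramid

/-- Pascal's recurrence, one term: lowering the `i`-th coordinate by one multiplies the
multinomial coefficient by `xᵢ / ∑ xⱼ`. -/
theorem realMultinomial_sub_single {n : ℕ} {x : Fin n → ℝ} (hx : ∀ j, 0 ≤ x j) (i : Fin n)
    (hi : 0 < x i) :
    realMultinomial (x - Pi.single i 1) = realMultinomial x * (x i / ∑ j, x j) := by
  have hs : 0 < ∑ j, x j := Finset.sum_pos' (fun j _ => hx j) ⟨i, Finset.mem_univ i, hi⟩
  have h1 : ∑ j, (x - Pi.single i (1 : ℝ) : Fin n → ℝ) j + 1 = ∑ j, x j := by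
    simp [Finset.sum_sub_distrib]
  have h2 : ∏ j, Real.Gamma (x j + 1) = x i * ∏ j, Real.Gamma ((x - Pi.single i (1 : ℝ) : Fin n → ℝ) j + 1) := by
    rw [← Finset.mul_prod_erase _ _ (Finset.mem_univ i),
      ← Finset.mul_prod_erase _ _ (Finset.mem_univ i), Real.Gamma_add_one hi.ne', mul_assoc]
    congr 2
    · simp
    · refine Finset.prod_congr rfl fun j hj => ?_
      simp [Finset.ne_of_mem_erase hj]
  have h3 : ∏ j, Real.Gamma ((x - Pi.single i (1 : ℝ) : Fin n → ℝ) j + 1) ≠ 0 := by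
    refine Finset.prod_ne_zero_iff.mpr fun j _ => (Real.Gamma_pos_of_pos ?_).ne'
    rcases eq_or_ne j i with rfl | hj
    · simpa using hi
    · simpa [hj] using by linarith [hx j]
  unfold realMultinomial
  rw [h1, h2, Real.Gamma_add_one hs.ne']
  field_simp

theorem realMultinomial_pos {n : ℕ} {x : Fin n → ℝ} (hx : ∀ j, 0 ≤ x j) :
    0 < realMultinomial x := by
  refine div_pos (Real.Gamma_pos_of_pos ?_)
    (Finset.prod_pos fun j _ => Real.Gamma_pos_of_pos (by linarith [hx j]))
  linarith [Finset.sum_nonneg fun j (_ : j ∈ Finset.univ) => hx j]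

theorem latticeSum_of_neg {n : ℕ} {a : Fin n → ℝ} (ha : ∀ i, 0 < a i) {z : ℝ} (hz : z < 0) :
    latticeSum a z = 0 := by
  have : latticePoints a z = ∅ := by
    refine eq_empty_of_forall_notMem fun k hk => ?_
    have := Finset.sum_nonneg fun i (_ : i ∈ Finset.univ) => mul_nonneg (ha i).le (hk.1 i)
    linarith [hk.2]
  rw [latticeSum, this, finsum_mem_empty]

theorem latticeSum_mono {n : ℕ} {a : Fin n → ℝ} (ha : ∀ i, 0 < a i) : Monotone (latticeSum a) := by
  intro z w hzw
  have hsub : latticePoints a z ⊆ latticePoints a w := fun k hk => ⟨hk.1, hk.2.trans hzw⟩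
  unfold latticeSum
  rw [finsum_mem_eq_finite_toFinset_sum _ (latticePoints_finite a ha z),
    finsum_mem_eq_finite_toFinset_sum _ (latticePoints_finite a ha w)]
  exact Finset.sum_le_sum_of_subset_of_nonneg (by simpa using hsub) fun _ _ _ => by positivity

/-- The lattice sum over the simplex shrunk by one step, as a sum over the original simplex. -/
theorem latticeSum_sub {n : ℕ} {a : Fin n → ℝ} (z : ℝ) (i : Fin n) :
    latticeSum a (z - a i) =
      ∑ᶠ k ∈ latticePoints a z, realMultinomial (fun j => (k j : ℝ)) * (k i / ∑ j, (k j : ℝ)) := by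
  set f : (Fin n → ℕ) → ℝ := fun k => realMultinomial (fun j => (k j : ℝ)) * (k i / ∑ j, (k j : ℝ))
  have himg : (fun k : Fin n → ℕ => k + Pi.single i 1) '' latticePoints a (z - a i) =
      latticePoints a z ∩ {k | k i ≠ 0} := by
    ext k
    constructor
    · rintro ⟨k, hk, rfl⟩
      refine ⟨⟨fun j => Nat.cast_nonneg _, ?_⟩, by simp⟩
      have := hk.2
      simp only [Pi.add_apply, Nat.cast_add, mul_add, Finset.sum_add_distrib]
      simp only [Pi.single_apply, Nat.cast_ite, mul_ite, Nat.cast_one, Nat.cast_zero, mul_one,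
        mul_zero, Finset.sum_ite_eq', Finset.mem_univ, if_true]
      linarith
    · rintro ⟨hk, hki⟩
      have hle : Pi.single i 1 ≤ k := by
        intro j
        rcases eq_or_ne j i with rfl | hj
        · simpa using Nat.one_le_iff_ne_zero.mpr hki
        · simp [hj]
      refine ⟨k - Pi.single i 1, ⟨fun j => Nat.cast_nonneg _, ?_⟩, tsub_add_cancel_of_le hle⟩
      have := hk.2
      have h1 : ∀ j, (((k - Pi.single i 1 : Fin n → ℕ) j : ℕ) : ℝ) = k j - (Pi.single i 1 : Fin n → ℝ) j := by
        intro j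
        rw [Pi.sub_apply, Nat.cast_sub (hle j)]
        simp [Pi.single_apply]
      simp only [h1, mul_sub, Finset.sum_sub_distrib]
      simp only [Pi.single_apply, mul_ite, mul_one, mul_zero, Finset.sum_ite_eq', Finset.mem_univ,
        if_true]
      linarith
  have hinj : Function.Injective fun k : Fin n → ℕ => k + Pi.single i 1 := add_left_injective _
  -- Points with kᵢ = 0 are not shifts of lattice points, but their summand vanishes (at the origin
  -- through 0/0 = 0).
  have hsupp : latticePoints a z ∩ {k | k i ≠ 0} ∩ Function.support f =
      latticePoints a z ∩ Function.support f := by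
    ext k
    simp only [mem_inter_iff, Function.mem_support, mem_ofPred_eq, and_assoc]
    refine and_congr_right fun _ => and_iff_right_of_imp fun hk hki => hk ?_
    simp [f, hki]
  rw [← finsum_mem_inter_support f, ← hsupp, finsum_mem_inter_support, ← himg,
    finsum_mem_image hinj.injOn]
  refine finsum_mem_congr rfl fun k _ => ?_
  have hpos : ∀ j, (0 : ℝ) ≤ ((k + Pi.single i 1 : Fin n → ℕ) j : ℕ) := fun j => Nat.cast_nonneg _
  have h1 : ((fun j => (((k + Pi.single i 1 : Fin n → ℕ) j : ℕ) : ℝ)) - Pi.single i 1) =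
      fun j => (k j : ℝ) := by
    ext j
    simp [Pi.single_apply]
  rw [← realMultinomial_natCast, ← h1]
  exact realMultinomial_sub_single hpos i (by simp; positivity)

/-- The shares kᵢ/∑ kⱼ add up to 1 away from the origin; at the origin they are all 0, so its
coefficient 1 is left over. -/
theorem latticeSum_renewal {n : ℕ} {a : Fin n → ℝ} (ha : ∀ i, 0 < a i) {z : ℝ} (hz : 0 ≤ z) :
    latticeSum a z = 1 + ∑ i, latticeSum a (z - a i) := by
  have hfin := latticePoints_finite a ha z
  have h0 : 0 ∈ hfin.toFinset := by
    simp [latticePoints, simplex, hz]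
  simp only [latticeSum_sub, finsum_mem_eq_finite_toFinset_sum _ hfin]
  rw [latticeSum, finsum_mem_eq_finite_toFinset_sum _ hfin, Finset.sum_comm, ← Finset.add_sum_erase _ _ h0, ← Finset.add_sum_erase _ _ h0]
  have h1 : (Nat.multinomial Finset.univ (0 : Fin n → ℕ) : ℝ) = 1 := by simp [Nat.multinomial]
  rw [h1]
  simp only [Pi.zero_apply, Nat.cast_zero, zero_div, mul_zero, Finset.sum_const_zero, zero_add]
  congr 1
  refine Finset.sum_congr rfl fun k hk => ?_
  have hk0 : ∑ j, (k j : ℝ) ≠ 0 := by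
    rw [← Nat.cast_sum, Nat.cast_ne_zero]
    intro h
    refine Finset.ne_of_mem_erase hk (funext fun j => ?_)
    exact Finset.sum_eq_zero_iff.mp h j (Finset.mem_univ j)
  rw [← Finset.mul_sum, ← Finset.sum_div, div_self hk0, mul_one, realMultinomial_natCast]

/-- The forcing term is e^{-z} on [0, ∞), of mass 1. -/
theorem tendsto_exp_neg_mul_latticeSum {n : ℕ} {a : Fin n → ℝ} (ha : ∀ i, 0 < a i)
    (hsum : ∑ i, Real.exp (-a i) = 1) {i k : Fin n} (hirr : Irrational (a i / a k)) :
    Tendsto (fun z => Real.exp (-z) * latticeSum a z) atTop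
      (𝓝 (1 / ∑ i, Real.exp (-a i) * a i)) := by
  have h1 : ∫ z, (Ici (0 : ℝ)).indicator (fun z => Real.exp (-z)) z = 1 := by
    rw [integral_indicator measurableSet_Ici, integral_Ici_eq_integral_Ioi,
      integral_exp_neg_Ioi_zero]
  rw [← h1]
  refine tendsto_of_renewal_equation (fun i => Real.exp_pos _) hsum ha hirr ?_ ?_ ?_ ?_
  · simpa [← mul_assoc, ← Real.exp_add] using latticeSum_mono ha
  · intro z hz
    rw [latticeSum_of_neg ha hz, mul_zero]
  · intro z
    rcases lt_or_ge z 0 with hz | hz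
    · rw [indicator_of_notMem (by simpa using hz), latticeSum_of_neg ha hz,
        Finset.sum_eq_zero fun i _ => by rw [latticeSum_of_neg ha (by linarith [ha i])]; simp]
      simp
    · rw [indicator_of_mem (by simpa using hz), latticeSum_renewal ha hz, mul_add, mul_one,
        Finset.mul_sum]
      congr 1
      refine Finset.sum_congr rfl fun i _ => ?_
      rw [← mul_assoc, ← Real.exp_add]
      ring_nf
  · refine IntegrableOn.integrable_indicator ?_ measurableSet_Ici
    rw [integrableOn_Ici_iff_integrableOn_Ioi]
    exact integrableOn_exp_neg_Ioi 0

end PascalPyramid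

/-! ### Gamma densities averaged over the shape -/

/-- Tonelli's theorem for a product of nonnegative functions of single coordinates. -/
theorem MeasureTheory.lintegral_fin_prod_eq_prod {n : ℕ} {f : Fin n → ℝ → ℝ≥0∞}
    (hf : ∀ i, Measurable (f i)) :
    ∫⁻ x : Fin n → ℝ, ∏ i, f i (x i) = ∏ i, ∫⁻ x, f i x := by
  induction n with
  | zero => simp [volume_pi]
  | succ n ih =>
    have hm : Measurable fun x : Fin n → ℝ => ∏ i : Fin n, f i.succ (x i) :=
      Finset.measurable_prod _ fun i _ => (hf _).comp (measurable_pi_apply i)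
    rw [← ((volume_preserving_piFinSuccAbove (fun _ : Fin (n + 1) => ℝ) 0).symm).lintegral_comp_emb
      (MeasurableEquiv.measurableEmbedding _), Fin.prod_univ_succ, ← ih fun i => hf i.succ,
      ← lintegral_prod_mul (hf 0).aemeasurable hm.aemeasurable]
    simp only [MeasurableEquiv.piFinSuccAbove_symm_apply, Fin.insertNthEquiv,
      Fin.prod_univ_succ, Fin.insertNth_zero, Equiv.coe_fn_mk, Fin.cons_succ, Fin.cons_zero]
    rfl

theorem Real.continuous_Gamma_inv : Continuous fun x : ℝ => (Real.Gamma x)⁻¹ := by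
  have h : Continuous fun x : ℝ => ((Complex.Gamma x)⁻¹).re :=
    Complex.continuous_re.comp
      (Complex.differentiable_one_div_Gamma.continuous.comp Complex.continuous_ofReal)
  refine h.congr fun x => ?_
  rw [Complex.Gamma_ofReal, ← Complex.ofReal_inv, Complex.ofReal_re]

theorem Real.measurable_Gamma : Measurable Real.Gamma := by
  have h := Real.continuous_Gamma_inv.measurable.inv
  have h' : (fun x : ℝ => (Real.Gamma x)⁻¹)⁻¹ = Real.Gamma := funext fun x => inv_inv _
  rwa [h'] at h

namespace PascalPyramid

/-- The density at `t` of the gamma distribution with shape `x` and unit rate. -/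
noncomputable def gammaDensity (x t : ℝ) : ℝ := Real.exp (-t) * t ^ (x - 1) * (Real.Gamma x)⁻¹

theorem measurable_gammaDensity : Measurable fun q : ℝ × ℝ => gammaDensity q.1 q.2 := by
  have h1 : Measurable fun q : ℝ × ℝ => (Real.Gamma q.1)⁻¹ :=
    Real.continuous_Gamma_inv.measurable.comp measurable_fst
  have h2 : Measurable fun q : ℝ × ℝ => q.2 ^ (q.1 - 1) :=
    measurable_snd.pow (measurable_fst.sub_const 1)
  have h3 : Measurable fun q : ℝ × ℝ => Real.exp (-q.2) :=
    Real.measurable_exp.comp measurable_snd.neg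
  exact (h3.mul h2).mul h1

theorem gammaDensity_nonneg {x t : ℝ} (hx : 0 < x) (ht : 0 ≤ t) : 0 ≤ gammaDensity x t :=
  mul_nonneg (mul_nonneg (Real.exp_pos _).le (Real.rpow_nonneg ht _))
    (inv_nonneg.mpr (Real.Gamma_pos_of_pos hx).le)

theorem integrableOn_gammaDensity {x : ℝ} (hx : 0 < x) :
    IntegrableOn (gammaDensity x) (Ioi 0) :=
  (Real.GammaIntegral_convergent hx).mul_const _

theorem integral_gammaDensity {x : ℝ} (hx : 0 < x) : ∫ t in Ioi 0, gammaDensity x t = 1 := by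
  simp only [gammaDensity]
  rw [integral_mul_const, ← Real.Gamma_eq_integral hx,
    mul_inv_cancel₀ (Real.Gamma_pos_of_pos hx).ne']

theorem lintegral_gammaDensity {x : ℝ} (hx : 0 < x) :
    ∫⁻ t in Ioi 0, ENNReal.ofReal (gammaDensity x t) = 1 := by
  rw [← ofReal_integral_eq_lintegral_ofReal (integrableOn_gammaDensity hx), integral_gammaDensity hx,
    ENNReal.ofReal_one]
  exact (ae_restrict_iff' measurableSet_Ioi).mpr
    (Eventually.of_forall fun t ht => gammaDensity_nonneg hx (le_of_lt ht))

theorem intervalIntegrable_gammaDensity {x s : ℝ} (hx : 0 < x) (hs : 0 ≤ s) :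
    IntervalIntegrable (gammaDensity x) volume 0 s := by
  rw [intervalIntegrable_iff_integrableOn_Ioc_of_le hs]
  exact (integrableOn_gammaDensity hx).mono_set Ioc_subset_Ioi_self

/-- The distribution function of the gamma law: raising the shape by one lowers it by a density. -/
theorem integral_gammaDensity_eq_add {x s : ℝ} (hx : 0 < x) (hs : 0 < s) :
    ∫ t in (0 : ℝ)..s, gammaDensity x t =
      gammaDensity (x + 1) s + ∫ t in (0 : ℝ)..s, gammaDensity (x + 1) t := by
  have hcont : Continuous (gammaDensity (x + 1)) := by
    have : Continuous fun t : ℝ => t ^ (x + 1 - 1) :=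
      Real.continuous_rpow_const (by linarith)
    unfold gammaDensity
    fun_prop
  have hderiv : ∀ t ∈ Ioo 0 s,
      HasDerivAt (gammaDensity (x + 1)) (gammaDensity x t - gammaDensity (x + 1) t) t := by
    intro t ht
    have h1 : HasDerivAt (fun t : ℝ => Real.exp (-t)) (Real.exp (-t) * -1) t :=
      (hasDerivAt_neg t).exp
    have h2 := (Real.hasDerivAt_rpow_const (p := x) (Or.inl ht.1.ne'))
    have h3 := (h1.mul h2).mul_const (Real.Gamma (x + 1))⁻¹
    have h4 : gammaDensity (x + 1) = fun t => Real.exp (-t) * t ^ x * (Real.Gamma (x + 1))⁻¹ := by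
      funext t
      rw [gammaDensity, add_sub_cancel_right]
    rw [h4]
    refine h3.congr_deriv ?_
    have := (Real.Gamma_pos_of_pos hx).ne'
    rw [gammaDensity, Real.Gamma_add_one hx.ne']
    field_simp
    ring
  have h := intervalIntegral.integral_eq_sub_of_hasDerivAt_of_le hs.le hcont.continuousOn hderiv
    ((intervalIntegrable_gammaDensity hx hs.le).sub
      (intervalIntegrable_gammaDensity (by linarith) hs.le))
  rw [intervalIntegral.integral_sub (intervalIntegrable_gammaDensity hx hs.le)
    (intervalIntegrable_gammaDensity (by linarith) hs.le)] at h
  have h0 : gammaDensity (x + 1) 0 = 0 := by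
    simp [gammaDensity, Real.zero_rpow hx.ne']
  linarith

/-- Iterating `integral_gammaDensity_eq_add` telescopes; the remainder is the distribution function
at shape x + N, which tends to 0. -/
theorem hasSum_gammaDensity {x s : ℝ} (hx : 0 < x) (hs : 0 < s) :
    HasSum (fun m : ℕ => gammaDensity (x + m + 1) s) (∫ t in (0 : ℝ)..s, gammaDensity x t) := by
  have hxm : ∀ m : ℕ, 0 < x + m := fun m => by positivity
  have hP : ∀ N : ℕ, ∑ m ∈ Finset.range N, gammaDensity (x + m + 1) s =
      (∫ t in (0 : ℝ)..s, gammaDensity x t) - ∫ t in (0 : ℝ)..s, gammaDensity (x + N) t := by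
    intro N
    induction N with
    | zero => simp
    | succ N ih =>
      rw [Finset.sum_range_succ, ih, integral_gammaDensity_eq_add (hxm N) hs]
      push_cast
      rw [add_assoc x]
      ring
  have hnn : ∀ m : ℕ, 0 ≤ gammaDensity (x + m + 1) s := fun m =>
    gammaDensity_nonneg (by linarith [hxm m]) hs.le
  have hPnn : ∀ m : ℕ, 0 ≤ ∫ t in (0 : ℝ)..s, gammaDensity (x + m) t := fun m =>
    intervalIntegral.integral_nonneg hs.le fun t ht => gammaDensity_nonneg (hxm m) ht.1
  have hsummable : Summable fun m : ℕ => gammaDensity (x + m + 1) s :=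
    summable_of_sum_range_le (c := ∫ t in (0 : ℝ)..s, gammaDensity x t) hnn fun N => by
      rw [hP]
      linarith [hPnn N]
  -- Dropping e^{-t} ≤ 1 from the integrand bounds the remainder by e^s times a term of the
  -- convergent series.
  have hle : ∀ m : ℕ, ∫ t in (0 : ℝ)..s, gammaDensity (x + m) t ≤
      Real.exp s * gammaDensity (x + m + 1) s := by
    intro m
    have h1 : ∫ t in (0 : ℝ)..s, t ^ (x + m - 1) * (Real.Gamma (x + m))⁻¹ =
        Real.exp s * gammaDensity (x + m + 1) s := by
      rw [intervalIntegral.integral_mul_const, integral_rpow (Or.inl (by linarith [hxm m])),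
        gammaDensity, Real.Gamma_add_one (hxm m).ne', sub_add_cancel, add_sub_cancel_right,
        Real.zero_rpow (hxm m).ne', Real.exp_neg]
      have := (Real.Gamma_pos_of_pos (hxm m)).ne'
      have := (Real.exp_pos s).ne'
      have := (hxm m).ne'
      field_simp
      ring
    rw [← h1]
    refine intervalIntegral.integral_mono_on hs.le (intervalIntegrable_gammaDensity (hxm m) hs.le)
      ((intervalIntegral.intervalIntegrable_rpow' (by linarith [hxm m])).mul_const _) fun t ht => ?_
    refine mul_le_mul_of_nonneg_right ?_ (inv_nonneg.mpr (Real.Gamma_pos_of_pos (hxm m)).le)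
    refine mul_le_of_le_one_left (Real.rpow_nonneg ht.1 _) ?_
    exact Real.exp_le_one_iff.mpr (by linarith [ht.1])
  rw [hsummable.hasSum_iff_tendsto_nat]
  have hlim : Tendsto (fun m : ℕ => ∫ t in (0 : ℝ)..s, gammaDensity (x + m) t) atTop (𝓝 0) := by
    refine squeeze_zero hPnn hle ?_
    simpa using hsummable.tendsto_atTop_zero.const_mul (Real.exp s)
  simp only [hP]
  simpa using hlim.const_sub (∫ t in (0 : ℝ)..s, gammaDensity x t)

/-- The gamma density at `t`, averaged over shapes in the unit interval. -/
noncomputable def meanDensity (t : ℝ) : ℝ := ∫ x in (0 : ℝ)..1, gammaDensity x t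

theorem continuous_gammaDensity_left {t : ℝ} (ht : 0 < t) :
    Continuous fun x => gammaDensity x t := by
  have h1 : Continuous fun x : ℝ => t ^ (x - 1) :=
    continuous_const.rpow (continuous_id.sub continuous_const) fun x => Or.inl ht.ne'
  exact (continuous_const.mul h1).mul Real.continuous_Gamma_inv

/-- The substitution t = e^y makes the integrand jointly continuous on all of ℝ², away from the
singularity of t^(x-1) at 0. -/
theorem continuousOn_meanDensity : ContinuousOn meanDensity (Ioi 0) := by
  have h1 : Continuous (Function.uncurry fun y x : ℝ =>
      Real.exp (-Real.exp y) * Real.exp (y * (x - 1)) * (Real.Gamma x)⁻¹) := by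
    have := Real.continuous_Gamma_inv.comp (continuous_snd (X := ℝ) (Y := ℝ))
    simp only [Function.comp_def] at this
    unfold Function.uncurry
    fun_prop
  have h2 := intervalIntegral.continuous_parametric_intervalIntegral_of_continuous' h1
    (μ := volume) 0 1
  refine (h2.comp_continuousOn (Real.continuousOn_log.mono fun t (ht : 0 < t) => ht.ne')).congr ?_
  intro t ht
  simp only [meanDensity, Function.comp, Real.exp_log ht, gammaDensity, Real.rpow_def_of_pos ht]

theorem meanDensity_nonneg {t : ℝ} (ht : 0 ≤ t) : 0 ≤ meanDensity t := by
  rw [meanDensity, intervalIntegral.integral_of_le zero_le_one]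
  exact setIntegral_nonneg measurableSet_Ioc fun x hx => gammaDensity_nonneg hx.1 ht

theorem ofReal_meanDensity {t : ℝ} (ht : 0 < t) :
    ENNReal.ofReal (meanDensity t) = ∫⁻ x in Ioc 0 1, ENNReal.ofReal (gammaDensity x t) := by
  rw [meanDensity, intervalIntegral.integral_of_le zero_le_one, ofReal_integral_eq_lintegral_ofReal]
  · exact (continuous_gammaDensity_left ht).integrableOn_Ioc
  · exact (ae_restrict_iff' measurableSet_Ioc).mpr
      (Eventually.of_forall fun x hx => gammaDensity_nonneg hx.1 ht.le)

theorem lintegral_meanDensity {s : Set ℝ} (hs : MeasurableSet s) (hs0 : s ⊆ Ioi 0) :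
    ∫⁻ t in s, ENNReal.ofReal (meanDensity t) =
      ∫⁻ x in Ioc 0 1, ∫⁻ t in s, ENNReal.ofReal (gammaDensity x t) := by
  rw [lintegral_lintegral_swap]
  · exact setLIntegral_congr_fun hs fun t ht => ofReal_meanDensity (hs0 ht)
  · exact measurable_gammaDensity.ennreal_ofReal.aemeasurable

theorem lintegral_meanDensity_Ioi : ∫⁻ t in Ioi 0, ENNReal.ofReal (meanDensity t) = 1 := by
  rw [lintegral_meanDensity measurableSet_Ioi subset_rfl,
    setLIntegral_congr_fun measurableSet_Ioc fun x hx => lintegral_gammaDensity hx.1]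
  simp

theorem integrableOn_meanDensity : IntegrableOn meanDensity (Ioi 0) := by
  refine ⟨continuousOn_meanDensity.aestronglyMeasurable measurableSet_Ioi, ?_⟩
  rw [hasFiniteIntegral_iff_ofReal, lintegral_meanDensity_Ioi]
  · exact ENNReal.one_lt_top
  · exact (ae_restrict_iff' measurableSet_Ioi).mpr
      (Eventually.of_forall fun t ht => meanDensity_nonneg (le_of_lt ht))

theorem integral_meanDensity : ∫ t in Ioi 0, meanDensity t = 1 := by
  rw [integral_eq_lintegral_of_nonneg_ae _ integrableOn_meanDensity.aestronglyMeasurable,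
    lintegral_meanDensity_Ioi, ENNReal.toReal_one]
  exact (ae_restrict_iff' measurableSet_Ioi).mpr
      (Eventually.of_forall fun t ht => meanDensity_nonneg (le_of_lt ht))

/-- The primitive of `meanDensity`; it equals `e⁻ˢ ∫₀^∞ sˣ / Γ(x + 1) dx`. -/
noncomputable def meanCDF (s : ℝ) : ℝ := ∫ t in (0 : ℝ)..s, meanDensity t

theorem Ioi_zero_eq_iUnion_Ioc : Ioi (0 : ℝ) = ⋃ m : ℕ, Ioc (m : ℝ) (m + 1) := by
  ext x
  simp only [mem_Ioi, mem_iUnion, mem_Ioc]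
  constructor
  · intro hx
    refine ⟨⌈x⌉₊ - 1, ?_⟩
    have h1 : 1 ≤ ⌈x⌉₊ := Nat.one_le_ceil_iff.mpr hx
    rw [Nat.cast_sub h1]
    have := Nat.ceil_lt_add_one hx.le
    have := Nat.le_ceil x
    constructor <;> push_cast <;> linarith
  · rintro ⟨m, hm, -⟩
    exact (Nat.cast_nonneg m).trans_lt hm

/-- The telescoped series, integrated over shapes in (0,1], lays the intervals (m, m + 1] end to end
and so covers all shapes x > 0. -/
theorem ofReal_meanCDF {s : ℝ} (hs : 0 < s) :
    ENNReal.ofReal (meanCDF s) = ∫⁻ x in Ioi 0, ENNReal.ofReal (gammaDensity (x + 1) s) := by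
  have h1 : ENNReal.ofReal (meanCDF s) = ∫⁻ t in Ioc 0 s, ENNReal.ofReal (meanDensity t) := by
    rw [meanCDF, intervalIntegral.integral_of_le hs.le, ofReal_integral_eq_lintegral_ofReal]
    · exact integrableOn_meanDensity.mono_set Ioc_subset_Ioi_self
    · exact (ae_restrict_iff' measurableSet_Ioc).mpr
        (Eventually.of_forall fun t ht => meanDensity_nonneg (le_of_lt ht.1))
  have hmeas : ∀ c : ℝ, Measurable fun x => ENNReal.ofReal (gammaDensity (x + c) s) := fun c =>
    ((continuous_gammaDensity_left hs).comp (continuous_add_const c)).measurable.ennreal_ofReal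
  have h2 : ∀ x ∈ Ioc (0 : ℝ) 1, ∫⁻ t in Ioc 0 s, ENNReal.ofReal (gammaDensity x t) =
      ∑' m : ℕ, ENNReal.ofReal (gammaDensity (x + (m + 1)) s) := by
    intro x hx
    have h3 := hasSum_gammaDensity hx.1 hs
    rw [← ofReal_integral_eq_lintegral_ofReal, ← intervalIntegral.integral_of_le hs.le, ← h3.tsum_eq,
      ENNReal.ofReal_tsum_of_nonneg _ h3.summable]
    · simp only [add_assoc]
    · exact fun m => gammaDensity_nonneg (by have := hx.1; positivity) hs.le
    · exact (integrableOn_gammaDensity hx.1).mono_set Ioc_subset_Ioi_self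
    · exact (ae_restrict_iff' measurableSet_Ioc).mpr
        (Eventually.of_forall fun t ht => gammaDensity_nonneg hx.1 (le_of_lt ht.1))
  rw [h1, lintegral_meanDensity measurableSet_Ioc Ioc_subset_Ioi_self,
    setLIntegral_congr_fun measurableSet_Ioc h2,
    lintegral_tsum fun m => (hmeas _).aemeasurable, Ioi_zero_eq_iUnion_Ioc,
    lintegral_iUnion (fun m => measurableSet_Ioc)]
  · refine tsum_congr fun m => ?_
    have h4 := (measurePreserving_add_right volume (m : ℝ)).setLIntegral_comp_preimage
      (measurableSet_Ioc (a := (m : ℝ)) (b := m + 1)) (hmeas 1)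
    rw [← h4]
    simp [add_assoc]
  · refine fun i j hij => Set.disjoint_left.mpr fun x hx hx' => hij ?_
    have h5 : (i : ℝ) < j + 1 := hx.1.trans_le hx'.2
    have h6 : (j : ℝ) < i + 1 := hx'.1.trans_le hx.2
    norm_cast at h5 h6
    omega

theorem hasDerivAt_meanCDF {s : ℝ} (hs : 0 < s) : HasDerivAt meanCDF (meanDensity s) s := by
  refine intervalIntegral.integral_hasDerivAt_right ?_ ?_
    (continuousOn_meanDensity.continuousAt (Ioi_mem_nhds hs))
  · rw [intervalIntegrable_iff_integrableOn_Ioc_of_le hs.le]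
    exact integrableOn_meanDensity.mono_set Ioc_subset_Ioi_self
  · exact continuousOn_meanDensity.stronglyMeasurableAtFilter isOpen_Ioi s hs

theorem meanCDF_zero : meanCDF 0 = 0 := intervalIntegral.integral_same

theorem continuousWithinAt_meanCDF : ContinuousWithinAt meanCDF (Ici 0) 0 := by
  have h1 : IntegrableOn meanDensity (Icc 0 1) := by
    rw [integrableOn_Icc_iff_integrableOn_Ioc]
    exact integrableOn_meanDensity.mono_set Ioc_subset_Ioi_self
  have h2 := intervalIntegral.continuousOn_primitive_interval
    (by rwa [uIcc_of_le zero_le_one]) |>.continuousWithinAt (left_mem_uIcc)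
  rw [uIcc_of_le zero_le_one] at h2
  exact h2.mono_of_mem_nhdsWithin (Icc_mem_nhdsGE zero_lt_one)

theorem tendsto_meanCDF : Tendsto meanCDF atTop (𝓝 1) := by
  rw [← integral_meanDensity]
  exact intervalIntegral_tendsto_integral_Ioi 0 integrableOn_meanDensity tendsto_id

theorem meanCDF_nonneg {s : ℝ} (hs : 0 ≤ s) : 0 ≤ meanCDF s :=
  intervalIntegral.integral_nonneg hs fun _ ht => meanDensity_nonneg ht.1

/-- The total variation of the product of rescaled copies of `meanCDF`. -/
theorem lintegral_deriv_prod_meanCDF {n : ℕ} (hn : 0 < n) {q : Fin n → ℝ} (hq : ∀ i, 0 < q i) :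
    ∫⁻ t in Ioi 0, ∑ i, ENNReal.ofReal (q i) * (ENNReal.ofReal (meanDensity (q i * t)) *
      ∏ j ∈ Finset.univ.erase i, ENNReal.ofReal (meanCDF (q j * t))) = 1 := by
  set F : ℝ → ℝ := fun t => ∏ i, meanCDF (q i * t) with hF
  set F' : ℝ → ℝ := fun t => ∑ i, q i * (meanDensity (q i * t) *
    ∏ j ∈ Finset.univ.erase i, meanCDF (q j * t)) with hF'
  have hderiv : ∀ t ∈ Ioi (0 : ℝ), HasDerivAt F (F' t) t := by
    intro t ht
    have h1 : ∀ i ∈ Finset.univ, HasDerivAt (fun t => meanCDF (q i * t))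
        (meanDensity (q i * t) * q i) t := fun i _ =>
      (hasDerivAt_meanCDF (mul_pos (hq i) ht)).comp t (hasDerivAt_const_mul (q i))
    refine (HasDerivAt.fun_finsetProd h1).congr_deriv ?_
    refine Finset.sum_congr rfl fun i _ => ?_
    rw [smul_eq_mul]
    ring
  have hterm : ∀ i, ∀ t ∈ Ioi (0 : ℝ), 0 ≤ q i * (meanDensity (q i * t) *
      ∏ j ∈ Finset.univ.erase i, meanCDF (q j * t)) := fun i t ht =>
    mul_nonneg (hq i).le (mul_nonneg (meanDensity_nonneg (mul_nonneg (hq i).le (le_of_lt ht)))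
      (Finset.prod_nonneg fun j _ => meanCDF_nonneg (mul_nonneg (hq j).le (le_of_lt ht))))
  have hnn : ∀ t ∈ Ioi (0 : ℝ), 0 ≤ F' t := fun t ht => Finset.sum_nonneg fun i _ => hterm i t ht
  have hlim : Tendsto F atTop (𝓝 1) := by
    have := tendsto_finsetProd Finset.univ fun i _ =>
      tendsto_meanCDF.comp (tendsto_id.const_mul_atTop (hq i))
    simpa using this
  have hcont : ContinuousWithinAt F (Ici 0) 0 := by
    have h1 : ∀ i, ContinuousWithinAt (fun t => meanCDF (q i * t)) (Ici 0) 0 := fun i => by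
      refine ContinuousWithinAt.comp (g := meanCDF) (t := Ici 0)
        (by simpa using continuousWithinAt_meanCDF)
        (continuous_const_mul (q i)).continuousWithinAt fun t ht => mul_nonneg (hq i).le ht
    exact tendsto_finsetProd Finset.univ fun i _ => h1 i
  -- Here n > 0 is essential: an empty product would start at 1.
  have h0 : F 0 = 0 := by
    simp only [hF, mul_zero, meanCDF_zero]
    exact Finset.prod_eq_zero (Finset.mem_univ ⟨0, hn⟩) rfl
  have hint := integrableOn_Ioi_deriv_of_nonneg hcont hderiv hnn hlim
  have heq := integral_Ioi_of_hasDerivAt_of_nonneg hcont hderiv hnn hlim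
  rw [h0, sub_zero] at heq
  rw [← ENNReal.ofReal_one, ← heq, ofReal_integral_eq_lintegral_ofReal hint
    ((ae_restrict_iff' measurableSet_Ioi).mpr (Eventually.of_forall hnn))]
  refine setLIntegral_congr_fun measurableSet_Ioi fun t ht => ?_
  have hV : ∀ i, 0 ≤ meanCDF (q i * t) := fun i => meanCDF_nonneg (mul_nonneg (hq i).le (le_of_lt ht))
  simp only [hF']
  rw [ENNReal.ofReal_sum_of_nonneg fun i _ => hterm i t ht]
  refine Finset.sum_congr rfl fun i _ => ?_
  rw [ENNReal.ofReal_mul (hq i).le,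
    ENNReal.ofReal_mul (meanDensity_nonneg (mul_nonneg (hq i).le (le_of_lt ht))),
    ENNReal.ofReal_prod_of_nonneg fun j _ => hV j]

/-! ### The simplex integral and its renewal equation -/

variable {n : ℕ} {a : Fin n → ℝ}

theorem isClosed_setOf_mem_simplex (a : Fin n → ℝ) :
    IsClosed {q : ℝ × (Fin n → ℝ) | q.2 ∈ simplex a q.1} := by
  have h1 : IsClosed {q : ℝ × (Fin n → ℝ) | ∀ i, 0 ≤ q.2 i} := by
    simp only [ofPred_forall]
    exact isClosed_iInter fun i => isClosed_le (by fun_prop) (by fun_prop)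
  exact h1.inter (isClosed_le (f := fun q : ℝ × (Fin n → ℝ) => ∑ i, a i * q.2 i) (by fun_prop)
    (by fun_prop))

theorem isCompact_simplex (ha : ∀ i, 0 < a i) (z : ℝ) : IsCompact (simplex a z) := by
  have h1 : IsClosed (simplex a z) :=
    (isClosed_setOf_mem_simplex a).preimage (continuous_const.prodMk continuous_id)
  refine (isCompact_Icc (a := (0 : Fin n → ℝ)) (b := fun i => z / a i)).of_isClosed_subset h1 ?_
  rintro x ⟨h0, hx⟩
  refine ⟨h0, fun i => ?_⟩
  rw [le_div_iff₀ (ha i), mul_comm]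
  exact (Finset.single_le_sum (f := fun i => a i * x i) (fun j _ => mul_nonneg (ha j).le (h0 j))
    (Finset.mem_univ i)).trans hx

theorem measurableSet_simplex (ha : ∀ i, 0 < a i) (z : ℝ) : MeasurableSet (simplex a z) :=
  (isCompact_simplex ha z).measurableSet

theorem measurable_realMultinomial : Measurable (realMultinomial (n := n)) := by
  have := Real.measurable_Gamma
  unfold realMultinomial
  fun_prop

theorem continuousOn_realMultinomial :
    ContinuousOn (realMultinomial (n := n)) {x | ∀ i, 0 ≤ x i} := by
  have h1 : ∀ t : ℝ, 0 ≤ t → ContinuousAt (fun t => Real.Gamma (t + 1)) t := fun t ht => by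
    refine ContinuousAt.comp (f := fun t : ℝ => t + 1) (g := Real.Gamma) ?_ (by fun_prop)
    refine (Real.differentiableAt_Gamma fun m => ?_).continuousAt
    have : (0 : ℝ) ≤ m := Nat.cast_nonneg m
    linarith
  refine fun x hx => ContinuousAt.continuousWithinAt (ContinuousAt.div ?_ ?_ ?_)
  · exact ContinuousAt.comp (f := fun x : Fin n → ℝ => ∑ i, x i)
      (h1 _ (Finset.sum_nonneg fun i _ => hx i)) (by fun_prop)
  · refine tendsto_finsetProd Finset.univ fun i _ => ?_
    exact ContinuousAt.comp (f := fun x : Fin n → ℝ => x i) (h1 _ (hx i)) (continuous_apply i).continuousAt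
  · exact Finset.prod_ne_zero_iff.mpr fun i _ =>
      (Real.Gamma_pos_of_pos (by linarith [hx i])).ne'

theorem integrableOn_realMultinomial (ha : ∀ i, 0 < a i) (z : ℝ) :
    IntegrableOn realMultinomial (simplex a z) :=
  (continuousOn_realMultinomial.mono fun _ hx => hx.1).integrableOn_compact (isCompact_simplex ha z)

theorem simplexIntegral_of_neg (ha : ∀ i, 0 < a i) {z : ℝ} (hz : z < 0) :
    simplexIntegral a z = 0 := by
  have : simplex a z = ∅ := by
    refine eq_empty_of_forall_notMem fun x hx => ?_
    have := Finset.sum_nonneg fun i (_ : i ∈ Finset.univ) => mul_nonneg (ha i).le (hx.1 i)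
    linarith [hx.2]
  rw [simplexIntegral, this, setIntegral_empty]

theorem simplexIntegral_mono (ha : ∀ i, 0 < a i) : Monotone (simplexIntegral a) := by
  intro z w hzw
  refine setIntegral_mono_set (integrableOn_realMultinomial ha w) ?_
    (Eventually.of_forall fun x hx => ⟨hx.1, hx.2.trans hzw⟩)
  exact (ae_restrict_iff' (measurableSet_simplex ha w)).mpr
    (Eventually.of_forall fun x hx => (realMultinomial_pos hx.1).le)

/-- The part of the multinomial coefficient that Pascal's recurrence assigns to the `i`-th
predecessor. -/
noncomputable def pascalTerm (i : Fin n) (x : Fin n → ℝ) : ℝ :=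
  realMultinomial x * (x i / ∑ j, x j)

theorem measurable_pascalTerm (i : Fin n) : Measurable (pascalTerm i) := by
  have := measurable_realMultinomial (n := n)
  unfold pascalTerm
  fun_prop

theorem pascalTerm_nonneg {x : Fin n → ℝ} (hx : ∀ j, 0 ≤ x j) (i : Fin n) : 0 ≤ pascalTerm i x :=
  mul_nonneg (realMultinomial_pos hx).le (div_nonneg (hx i) (Finset.sum_nonneg fun j _ => hx j))

theorem integrableOn_pascalTerm (ha : ∀ i, 0 < a i) (z : ℝ) (i : Fin n) :
    IntegrableOn (pascalTerm i) (simplex a z) := by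
  refine (integrableOn_realMultinomial ha z).mono' (measurable_pascalTerm i).aestronglyMeasurable
    ((ae_restrict_iff' (measurableSet_simplex ha z)).mpr (Eventually.of_forall fun x hx => ?_))
  rw [Real.norm_of_nonneg (pascalTerm_nonneg hx.1 i)]
  refine mul_le_of_le_one_right (realMultinomial_pos hx.1).le ?_
  exact div_le_one_of_le₀ (Finset.single_le_sum (fun j _ => hx.1 j) (Finset.mem_univ i))
    (Finset.sum_nonneg fun j _ => hx.1 j)

theorem measurableSet_one_le (i : Fin n) : MeasurableSet {x : Fin n → ℝ | 1 ≤ x i} :=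
  measurableSet_le measurable_const (measurable_pi_apply i)

/-- The integral over the simplex shrunk by one step, as an integral over the original simplex. -/
theorem simplexIntegral_sub (ha : ∀ i, 0 < a i) (z : ℝ) (i : Fin n) :
    simplexIntegral a (z - a i) =
      ∫ x in simplex a z, {x : Fin n → ℝ | 1 ≤ x i}.indicator (pascalTerm i) x := by
  rw [simplexIntegral, ← integral_indicator (measurableSet_simplex ha _),
    ← integral_indicator (measurableSet_simplex ha _),
    ← integral_sub_right_eq_self _ (Pi.single i (1 : ℝ) : Fin n → ℝ)]
  congr 1
  funext x
  have hsum : ∑ j, a j * (x - Pi.single i (1 : ℝ) : Fin n → ℝ) j = (∑ j, a j * x j) - a i := by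
    simp [mul_sub, Finset.sum_sub_distrib, Pi.single_apply]
  have hmem : x - Pi.single i 1 ∈ simplex a (z - a i) ↔ x ∈ simplex a z ∧ 1 ≤ x i := by
    simp only [simplex, mem_ofPred_eq, hsum, sub_le_sub_iff_right]
    constructor
    · rintro ⟨h0, hx⟩
      have hi : 1 ≤ x i := by simpa using h0 i
      refine ⟨⟨fun j => ?_, hx⟩, hi⟩
      rcases eq_or_ne j i with rfl | hj
      · linarith
      · simpa [hj] using h0 j
    · rintro ⟨⟨h0, hx⟩, hi⟩
      refine ⟨fun j => ?_, hx⟩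
      rcases eq_or_ne j i with rfl | hj
      · simpa using hi
      · simpa [hj] using h0 j
  by_cases hx : x ∈ simplex a z
  · by_cases hi : 1 ≤ x i
    · rw [indicator_of_mem (hmem.mpr ⟨hx, hi⟩), indicator_of_mem hx, indicator_of_mem (by exact hi),
        realMultinomial_sub_single hx.1 i (by linarith), pascalTerm]
    · rw [indicator_of_notMem fun h => hi (hmem.mp h).2, indicator_of_mem hx,
        indicator_of_notMem (by exact hi)]
  · rw [indicator_of_notMem fun h => hx (hmem.mp h).1, indicator_of_notMem hx]

/-- What is left of the multinomial coefficient in Pascal's recurrence when predecessors with a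
negative coordinate are dropped. -/
noncomputable def boundaryDensity (x : Fin n → ℝ) : ℝ :=
  ∑ i, {x : Fin n → ℝ | x i < 1}.indicator (pascalTerm i) x

theorem measurable_boundaryDensity : Measurable (boundaryDensity (n := n)) :=
  Finset.measurable_sum _ fun i _ => (measurable_pascalTerm i).indicator
    (measurableSet_lt (measurable_pi_apply i) measurable_const)

theorem boundaryDensity_nonneg {x : Fin n → ℝ} (hx : ∀ j, 0 ≤ x j) : 0 ≤ boundaryDensity x :=
  Finset.sum_nonneg fun i _ => indicator_apply_nonneg fun _ => pascalTerm_nonneg hx i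

theorem integrableOn_boundaryDensity (ha : ∀ i, 0 < a i) (z : ℝ) :
    IntegrableOn boundaryDensity (simplex a z) :=
  integrable_finsetSum _ fun i _ => (integrableOn_pascalTerm ha z i).indicator
    (measurableSet_lt (measurable_pi_apply i) measurable_const)

theorem simplexIntegral_renewal (hn : 0 < n) (ha : ∀ i, 0 < a i) (z : ℝ) :
    simplexIntegral a z =
      (∫ x in simplex a z, boundaryDensity x) + ∑ i, simplexIntegral a (z - a i) := by
  have hint : ∀ i, IntegrableOn ({x : Fin n → ℝ | 1 ≤ x i}.indicator (pascalTerm i))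
      (simplex a z) := fun i => (integrableOn_pascalTerm ha z i).indicator (measurableSet_one_le i)
  simp only [simplexIntegral_sub ha]
  rw [← integral_finsetSum _ fun i _ => hint i, ← integral_add (integrableOn_boundaryDensity ha z)
    (integrable_finsetSum _ fun i _ => hint i)]
  refine setIntegral_congr_ae (measurableSet_simplex ha z) ?_
  -- Off a null set ∑ xⱼ > 0, so the shares xᵢ/∑ xⱼ add up to 1.
  filter_upwards [Measure.ae_eval_ne (μ := fun _ : Fin n => (volume : Measure ℝ)) ⟨0, hn⟩ 0]
    with x hx0 hx
  rw [boundaryDensity, ← Finset.sum_add_distrib]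
  have h1 : ∀ i, {x : Fin n → ℝ | x i < 1}.indicator (pascalTerm i) x +
      {x : Fin n → ℝ | 1 ≤ x i}.indicator (pascalTerm i) x = pascalTerm i x := by
    intro i
    by_cases hi : x i < 1
    · rw [indicator_of_mem (by exact hi), indicator_of_notMem (by simpa using hi), add_zero]
    · rw [indicator_of_notMem (by exact hi), indicator_of_mem (by simpa using hi), zero_add]
  have h2 : 0 < ∑ j, x j := Finset.sum_pos' (fun j _ => hx.1 j)
    ⟨⟨0, hn⟩, Finset.mem_univ _, (hx.1 _).lt_of_ne' hx0⟩
  simp only [h1, pascalTerm]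
  rw [← Finset.mul_sum, ← Finset.sum_div, div_self h2.ne', mul_one]

/-! ### Total mass of the boundary term -/

theorem lintegral_Ici_exp_neg (c : ℝ) :
    ∫⁻ z in Ici c, ENNReal.ofReal (Real.exp (-z)) = ENNReal.ofReal (Real.exp (-c)) := by
  rw [← ofReal_integral_eq_lintegral_ofReal, integral_Ici_eq_integral_Ioi, integral_exp_neg_Ioi]
  · exact (integrableOn_Ici_iff_integrableOn_Ioi).mpr (integrableOn_exp_neg_Ioi c)
  · exact Eventually.of_forall fun z => (Real.exp_pos _).le

/-- The Laplace transform at `1` of the boundary term in the renewal equation. -/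
theorem lintegral_exp_neg_mul_boundaryDensity (ha : ∀ i, 0 < a i) :
    ∫⁻ z, ENNReal.ofReal (Real.exp (-z) * ∫ x in simplex a z, boundaryDensity x) =
      ∫⁻ x in {x : Fin n → ℝ | ∀ i, 0 ≤ x i},
        ENNReal.ofReal (boundaryDensity x) * ENNReal.ofReal (Real.exp (-∑ i, a i * x i)) := by
  set T : Set (ℝ × (Fin n → ℝ)) := {q | q.2 ∈ simplex a q.1} with hT
  have hTm : MeasurableSet T := (isClosed_setOf_mem_simplex a).measurableSet
  set f : ℝ × (Fin n → ℝ) → ℝ≥0∞ := T.indicator fun q =>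
    ENNReal.ofReal (boundaryDensity q.2) * ENNReal.ofReal (Real.exp (-q.1)) with hf
  have hfm : Measurable f := by
    have h1 : Measurable fun q : ℝ × (Fin n → ℝ) => boundaryDensity q.2 :=
      measurable_boundaryDensity.comp measurable_snd
    exact Measurable.indicator (by fun_prop) hTm
  have h1 : ∀ z, ENNReal.ofReal (Real.exp (-z) * ∫ x in simplex a z, boundaryDensity x) =
      ∫⁻ x, f (z, x) := by
    intro z
    have h2 : ∀ x, f (z, x) = (simplex a z).indicator (fun x =>
        ENNReal.ofReal (boundaryDensity x) * ENNReal.ofReal (Real.exp (-z))) x := fun x => rfl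
    simp only [h2]
    rw [lintegral_indicator (measurableSet_simplex ha z),
      lintegral_mul_const _ measurable_boundaryDensity.ennreal_ofReal, mul_comm,
      ENNReal.ofReal_mul' (Real.exp_pos _).le,
      ofReal_integral_eq_lintegral_ofReal (integrableOn_boundaryDensity ha z)
        ((ae_restrict_iff' (measurableSet_simplex ha z)).mpr
          (Eventually.of_forall fun x hx => boundaryDensity_nonneg hx.1))]
  have hpos : MeasurableSet {x : Fin n → ℝ | ∀ i, 0 ≤ x i} := by
    simp only [ofPred_forall]
    exact MeasurableSet.iInter fun i => measurableSet_le measurable_const (measurable_pi_apply i)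
  simp only [h1]
  -- A point x ≥ 0 belongs to S(z) exactly when z ≥ a·x, so integrating e^{-z} first leaves
  -- e^{-a·x}.
  rw [lintegral_lintegral_swap (f := fun z x => f (z, x)) hfm.aemeasurable,
    ← lintegral_indicator hpos]
  refine lintegral_congr fun x => ?_
  by_cases hx : ∀ i, 0 ≤ x i
  · rw [indicator_of_mem (by exact hx)]
    have h2 : ∀ z, f (z, x) = (Ici (∑ i, a i * x i)).indicator (fun z =>
        ENNReal.ofReal (boundaryDensity x) * ENNReal.ofReal (Real.exp (-z))) z := fun z => by
      by_cases hz : ∑ i, a i * x i ≤ z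
      · rw [indicator_of_mem (by exact hz), hf, indicator_of_mem (by exact ⟨hx, hz⟩)]
      · rw [indicator_of_notMem (by exact hz), hf, indicator_of_notMem (by exact fun h => hz h.2)]
    simp only [h2]
    rw [lintegral_indicator measurableSet_Ici, lintegral_const_mul _ (by fun_prop),
      lintegral_Ici_exp_neg]
  · rw [indicator_of_notMem (by exact hx)]
    have h2 : ∀ z, f (z, x) = 0 := fun z => indicator_of_notMem (by exact fun h => hx h.1) _
    simp only [h2, lintegral_zero]

theorem mul_gammaDensity {x t : ℝ} (hx : 0 < x) (ht : 0 < t) :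
    t * gammaDensity x t = x * gammaDensity (x + 1) t := by
  have h1 : t ^ (x + 1 - 1) = t ^ (x - 1) * t := by
    rw [← Real.rpow_add_one ht.ne']
    ring_nf
  have := (Real.Gamma_pos_of_pos hx).ne'
  rw [gammaDensity, gammaDensity, h1, Real.Gamma_add_one hx.ne']
  field_simp

/-- Because the rates e^{-aⱼ} add up to 1, the exponentials merge into e^{-t}, while the powers of
the rates produce the discount e^{-a·x}. -/
theorem prod_gammaDensity (hsum : ∑ i, Real.exp (-a i) = 1) {x : Fin n → ℝ} {t : ℝ} (ht : 0 < t) :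
    ∏ j, gammaDensity (x j + 1) (Real.exp (-a j) * t) =
      Real.exp (-t) * t ^ (∑ j, x j) * Real.exp (-∑ j, a j * x j) *
        (∏ j, Real.Gamma (x j + 1))⁻¹ := by
  have h1 : ∏ j, Real.exp (-(Real.exp (-a j) * t)) = Real.exp (-t) := by
    rw [← Real.exp_sum, Finset.sum_neg_distrib, ← Finset.sum_mul, hsum, one_mul]
  have h2 : ∏ j, t ^ (x j) = t ^ (∑ j, x j) := (Real.rpow_sum_of_pos ht _ _).symm
  have h3 : ∏ j, Real.exp (-a j) ^ (x j) = Real.exp (-∑ j, a j * x j) := by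
    rw [← Finset.sum_neg_distrib, Real.exp_sum]
    refine Finset.prod_congr rfl fun j _ => ?_
    rw [← Real.exp_mul, neg_mul]
  rw [← h1, ← h2, ← h3, ← Finset.prod_inv_distrib, ← Finset.prod_mul_distrib,
    ← Finset.prod_mul_distrib, ← Finset.prod_mul_distrib]
  refine Finset.prod_congr rfl fun j _ => ?_
  rw [gammaDensity, add_sub_cancel_right, Real.mul_rpow (Real.exp_pos _).le ht.le]
  ring

/-- Poissonization: a term of Pascal's recurrence, discounted by `exp`, is a mixture of products of
gamma densities. -/
theorem pascalTerm_eq_lintegral (hsum : ∑ i, Real.exp (-a i) = 1) {x : Fin n → ℝ}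
    (hx : ∀ j, 0 < x j) (i : Fin n) :
    ENNReal.ofReal (pascalTerm i x) * ENNReal.ofReal (Real.exp (-∑ j, a j * x j)) =
      ∫⁻ t in Ioi 0, ENNReal.ofReal (Real.exp (-a i)) *
        (ENNReal.ofReal (gammaDensity (x i) (Real.exp (-a i) * t)) *
          ∏ j ∈ Finset.univ.erase i,
            ENNReal.ofReal (gammaDensity (x j + 1) (Real.exp (-a j) * t))) := by
  set σ := ∑ j, x j with hσ
  have hσ0 : 0 < σ := Finset.sum_pos (fun j _ => hx j) ⟨i, Finset.mem_univ i⟩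
  set C := pascalTerm i x * Real.exp (-∑ j, a j * x j) with hC
  have hC0 : 0 ≤ C := mul_nonneg (pascalTerm_nonneg (fun j => (hx j).le) i) (Real.exp_pos _).le
  have hterm : ∀ t ∈ Ioi (0 : ℝ), ENNReal.ofReal (Real.exp (-a i)) *
        (ENNReal.ofReal (gammaDensity (x i) (Real.exp (-a i) * t)) *
          ∏ j ∈ Finset.univ.erase i,
            ENNReal.ofReal (gammaDensity (x j + 1) (Real.exp (-a j) * t))) =
      ENNReal.ofReal C * ENNReal.ofReal (gammaDensity σ t) := by
    intro t ht
    have ht : 0 < t := ht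
    have hqt : ∀ j, 0 < Real.exp (-a j) * t := fun j => mul_pos (Real.exp_pos _) ht
    rw [← ENNReal.ofReal_prod_of_nonneg fun j _ =>
        gammaDensity_nonneg (by linarith [hx j]) (hqt j).le,
      ← ENNReal.ofReal_mul (gammaDensity_nonneg (hx i) (hqt i).le),
      ← ENNReal.ofReal_mul (Real.exp_pos _).le, ← ENNReal.ofReal_mul hC0]
    congr 1
    have h1 := mul_gammaDensity (hx i) (hqt i)
    have h2 := prod_gammaDensity hsum (x := x) ht
    rw [← Finset.mul_prod_erase _ _ (Finset.mem_univ i)] at h2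
    have h3 : t ^ σ = t ^ (σ - 1) * t := by
      rw [← Real.rpow_add_one ht.ne']
      ring_nf
    have h4 : C * gammaDensity σ t * t = x i * (Real.exp (-t) * t ^ σ *
        Real.exp (-∑ j, a j * x j) * (∏ j, Real.Gamma (x j + 1))⁻¹) := by
      have h5 := (Real.Gamma_pos_of_pos hσ0).ne'
      rw [hC, pascalTerm, realMultinomial, ← hσ, Real.Gamma_add_one hσ0.ne', gammaDensity, h3]
      field_simp
    -- The extra factor t raises the shape xᵢ to xᵢ + 1, making the product symmetric in the
    -- coordinates so that `prod_gammaDensity` applies.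
    refine mul_right_cancel₀ ht.ne' ?_
    rw [h4, ← h2]
    linear_combination (∏ j ∈ Finset.univ.erase i,
      gammaDensity (x j + 1) (Real.exp (-a j) * t)) * h1
  have hm : Measurable fun t => ENNReal.ofReal (gammaDensity σ t) :=
    (measurable_gammaDensity.comp measurable_prodMk_left).ennreal_ofReal
  rw [setLIntegral_congr_fun measurableSet_Ioi hterm, lintegral_const_mul _ hm,
    lintegral_gammaDensity hσ0, mul_one, hC,
    ENNReal.ofReal_mul (pascalTerm_nonneg (fun j => (hx j).le) i)]

theorem lintegral_boundaryDensity (hn : 0 < n) (hsum : ∑ i, Real.exp (-a i) = 1) :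
    ∫⁻ x in {x : Fin n → ℝ | ∀ i, 0 ≤ x i},
      ENNReal.ofReal (boundaryDensity x) * ENNReal.ofReal (Real.exp (-∑ i, a i * x i)) = 1 := by
  set q : Fin n → ℝ := fun i => Real.exp (-a i) with hq
  have hq0 : ∀ i, 0 < q i := fun i => Real.exp_pos _
  have hpos : MeasurableSet {x : Fin n → ℝ | ∀ i, 0 ≤ x i} := by
    simp only [ofPred_forall]
    exact MeasurableSet.iInter fun i => measurableSet_le measurable_const (measurable_pi_apply i)
  -- The cutoffs are built into one-variable factors, so that for fixed t the x-integral splits: the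
  -- factor j = i gives `meanDensity`, the others `meanCDF`.
  set φ : Fin n → Fin n → ℝ → ℝ → ℝ≥0∞ := fun i j t =>
    if j = i then (Ioo 0 1).indicator fun y => ENNReal.ofReal (gammaDensity y (q j * t))
    else (Ioi 0).indicator fun y => ENNReal.ofReal (gammaDensity (y + 1) (q j * t)) with hφ
  have hprod : ∀ (i : Fin n) (t : ℝ) (x : Fin n → ℝ), ∏ j, φ i j t (x j) = φ i i t (x i) * ∏ j ∈ Finset.univ.erase i,
      (Ioi 0).indicator (fun y => ENNReal.ofReal (gammaDensity (y + 1) (q j * t))) (x j) := by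
    intro i t x
    rw [← Finset.mul_prod_erase _ _ (Finset.mem_univ i)]
    congr 1
    refine Finset.prod_congr rfl fun j hj => ?_
    simp only [hφ, if_neg (Finset.ne_of_mem_erase hj)]
  have hmeas : ∀ i j, Measurable fun p : ℝ × ℝ => φ i j p.1 p.2 := by
    intro i j
    have h1 : ∀ c : ℝ, Measurable fun p : ℝ × ℝ =>
        ENNReal.ofReal (gammaDensity (p.2 + c) (q j * p.1)) := fun c =>
      (measurable_gammaDensity.comp
        ((measurable_snd.add_const c).prodMk (measurable_fst.const_mul (q j)))).ennreal_ofReal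
    by_cases hij : j = i
    · simp only [hφ, if_pos hij]
      have := (h1 0).indicator (measurable_snd (measurableSet_Ioo (a := (0 : ℝ)) (b := 1)))
      simp only [add_zero] at this
      exact this
    · simp only [hφ, if_neg hij]
      exact (h1 1).indicator (measurable_snd (measurableSet_Ioi (a := (0 : ℝ))))
  have hmeas' : ∀ i, Measurable fun p : (Fin n → ℝ) × ℝ =>
      ENNReal.ofReal (q i) * ∏ j, φ i j p.2 (p.1 j) := fun i =>
    (Finset.measurable_fun_prod _ fun j _ => (hmeas i j).comp
      (measurable_snd.prodMk ((measurable_pi_apply j).comp measurable_fst))).const_mul _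
  have hpt : ∀ᵐ x : Fin n → ℝ, {x : Fin n → ℝ | ∀ i, 0 ≤ x i}.indicator (fun x =>
      ENNReal.ofReal (boundaryDensity x) * ENNReal.ofReal (Real.exp (-∑ i, a i * x i))) x =
      ∑ i, ∫⁻ t in Ioi 0, ENNReal.ofReal (q i) * ∏ j, φ i j t (x j) := by
    -- Poissonization needs strictly positive shapes; the coordinate hyperplanes are null.
    have hne : ∀ᵐ x : Fin n → ℝ, ∀ i, x i ≠ 0 := ae_all_iff.mpr fun i =>
      Measure.ae_eval_ne (μ := fun _ : Fin n => (volume : Measure ℝ)) i 0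
    filter_upwards [hne] with x hx0
    by_cases hx : ∀ i, 0 ≤ x i
    · have hx' : ∀ i, 0 < x i := fun i => (hx i).lt_of_ne' (hx0 i)
      rw [indicator_of_mem (by exact hx), boundaryDensity,
        ENNReal.ofReal_sum_of_nonneg fun i _ =>
          indicator_apply_nonneg fun _ => pascalTerm_nonneg hx i, Finset.sum_mul]
      refine Finset.sum_congr rfl fun i _ => ?_
      have h1 : ∀ t, ∏ j ∈ Finset.univ.erase i,
          (Ioi 0).indicator (fun y => ENNReal.ofReal (gammaDensity (y + 1) (q j * t))) (x j) =
          ∏ j ∈ Finset.univ.erase i, ENNReal.ofReal (gammaDensity (x j + 1) (q j * t)) := fun t =>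
        Finset.prod_congr rfl fun j _ => indicator_of_mem (hx' j) _
      simp only [hprod, h1]
      simp only [hφ, if_true]
      by_cases hi : x i < 1
      · rw [indicator_of_mem (by exact hi), pascalTerm_eq_lintegral hsum hx' i]
        simp only [indicator_of_mem (show x i ∈ Ioo (0 : ℝ) 1 from ⟨hx' i, hi⟩), hq]
      · rw [indicator_of_notMem (by exact hi)]
        simp only [indicator_of_notMem (show x i ∉ Ioo (0 : ℝ) 1 from fun h => hi h.2)]
        simp
    · rw [indicator_of_notMem (by exact hx)]
      push Not at hx
      obtain ⟨j, hj⟩ := hx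
      refine (Finset.sum_eq_zero fun i _ => ?_).symm
      have h1 : ∀ t, ∏ j, φ i j t (x j) = 0 := fun t => by
        refine Finset.prod_eq_zero (Finset.mem_univ j) ?_
        by_cases hij : j = i
        · simp only [hφ, if_pos hij]
          exact indicator_of_notMem (fun h => hj.not_gt h.1) _
        · simp only [hφ, if_neg hij]
          exact indicator_of_notMem (fun h => hj.not_gt h) _
      simp only [h1, mul_zero, lintegral_zero]
  rw [← lintegral_indicator hpos, lintegral_congr_ae hpt,
    lintegral_finsetSum _ fun i _ => (hmeas' i).lintegral_prod_right']
  have hswap : ∀ i, ∫⁻ x : Fin n → ℝ, ∫⁻ t in Ioi 0, ENNReal.ofReal (q i) * ∏ j, φ i j t (x j) =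
      ∫⁻ t in Ioi 0, ENNReal.ofReal (q i) * (ENNReal.ofReal (meanDensity (q i * t)) *
        ∏ j ∈ Finset.univ.erase i, ENNReal.ofReal (meanCDF (q j * t))) := by
    intro i
    rw [lintegral_lintegral_swap (hmeas' i).aemeasurable]
    refine setLIntegral_congr_fun measurableSet_Ioi fun t ht => ?_
    have hqt : ∀ j, 0 < q j * t := fun j => mul_pos (hq0 j) ht
    have hm : ∀ j, Measurable (φ i j t) := fun j => (hmeas i j).comp measurable_prodMk_left
    have hpm : Measurable fun x : Fin n → ℝ => ∏ j, φ i j t (x j) :=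
      Finset.measurable_fun_prod _ fun j _ => (hm j).comp (measurable_pi_apply j)
    rw [lintegral_const_mul _ hpm, lintegral_fin_prod_eq_prod hm,
      ← Finset.mul_prod_erase _ _ (Finset.mem_univ i)]
    congr 2
    · simp only [hφ, if_true]
      rw [lintegral_indicator measurableSet_Ioo, ofReal_meanDensity (hqt i),
        setLIntegral_congr Ioo_ae_eq_Ioc]
    · refine Finset.prod_congr rfl fun j hj => ?_
      simp only [hφ, if_neg (Finset.ne_of_mem_erase hj)]
      rw [lintegral_indicator measurableSet_Ioi, ofReal_meanCDF (hqt j)]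
  simp only [hswap]
  have hscale : ∀ j, MapsTo (fun t => q j * t) (Ioi 0) (Ioi 0) := fun j t ht => mul_pos (hq0 j) ht
  have hdm : ∀ j, AEMeasurable (fun t => ENNReal.ofReal (meanDensity (q j * t)))
      (volume.restrict (Ioi 0)) := fun j =>
    ((continuousOn_meanDensity.comp (continuous_const_mul (q j)).continuousOn
      (hscale j)).aemeasurable measurableSet_Ioi).ennreal_ofReal
  have hcm : ∀ j, AEMeasurable (fun t => ENNReal.ofReal (meanCDF (q j * t)))
      (volume.restrict (Ioi 0)) := fun j => by
    have h1 : ContinuousOn meanCDF (Ioi 0) := fun s hs =>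
      (hasDerivAt_meanCDF hs).continuousAt.continuousWithinAt
    exact ((h1.comp (continuous_const_mul (q j)).continuousOn
      (hscale j)).aemeasurable measurableSet_Ioi).ennreal_ofReal
  have htm : ∀ i, AEMeasurable (fun t => ENNReal.ofReal (q i) *
      (ENNReal.ofReal (meanDensity (q i * t)) *
        ∏ j ∈ Finset.univ.erase i, ENNReal.ofReal (meanCDF (q j * t))))
      (volume.restrict (Ioi 0)) := fun i =>
    ((hdm i).mul (Finset.aemeasurable_fun_prod _ fun j _ => hcm j)).const_mul _
  rw [← lintegral_finsetSum' _ fun i _ => htm i, lintegral_deriv_prod_meanCDF hn hq0]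

/-! ### The two limits compared -/

theorem tendsto_exp_neg_mul_simplexIntegral (ha : ∀ i, 0 < a i)
    (hsum : ∑ i, Real.exp (-a i) = 1) {i k : Fin n} (hirr : Irrational (a i / a k)) :
    Tendsto (fun z => Real.exp (-z) * simplexIntegral a z) atTop
      (𝓝 (1 / ∑ i, Real.exp (-a i) * a i)) := by
  have hn : 0 < n := i.pos
  set h : ℝ → ℝ := fun z => Real.exp (-z) * ∫ x in simplex a z, boundaryDensity x with hh
  have hh0 : ∀ z, 0 ≤ h z := fun z => mul_nonneg (Real.exp_pos _).le
    (setIntegral_nonneg (measurableSet_simplex ha z) fun x hx => boundaryDensity_nonneg hx.1)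
  have hlin : ∫⁻ z, ENNReal.ofReal (h z) = 1 := by
    rw [lintegral_exp_neg_mul_boundaryDensity ha, lintegral_boundaryDensity hn hsum]
  have hmeas : Measurable h := by
    have h1 : Monotone fun z => ∫ x in simplex a z, boundaryDensity x := fun z w hzw =>
      setIntegral_mono_set (integrableOn_boundaryDensity ha w)
        ((ae_restrict_iff' (measurableSet_simplex ha w)).mpr
          (Eventually.of_forall fun x hx => boundaryDensity_nonneg hx.1))
        (Eventually.of_forall fun x hx => ⟨hx.1, hx.2.trans hzw⟩)
    exact (Real.measurable_exp.comp measurable_neg).mul h1.measurable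
  have hint : Integrable h := by
    refine ⟨hmeas.aestronglyMeasurable, ?_⟩
    rw [hasFiniteIntegral_iff_ofReal (Eventually.of_forall hh0), hlin]
    exact ENNReal.one_lt_top
  have h1 : ∫ z, h z = 1 := by
    rw [integral_eq_lintegral_of_nonneg_ae (Eventually.of_forall hh0) hmeas.aestronglyMeasurable,
      hlin, ENNReal.toReal_one]
  rw [← h1]
  refine tendsto_of_renewal_equation (fun i => Real.exp_pos _) hsum ha hirr ?_ ?_ ?_ hint
  · simpa [← mul_assoc, ← Real.exp_add] using simplexIntegral_mono ha
  · intro z hz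
    rw [simplexIntegral_of_neg ha hz, mul_zero]
  · intro z
    rw [simplexIntegral_renewal hn ha, mul_add, Finset.mul_sum]
    congr 1
    refine Finset.sum_congr rfl fun i _ => ?_
    rw [← mul_assoc, ← Real.exp_add]
    ring_nf

end PascalPyramid

theorem mainTheorem3 (n : ℕ) (a : Fin n → ℝ) (ha : ∀ i, 0 < a i)
    (hsum : ∑ i, Real.exp (-a i) = 1)
    (hirr : ∃ i k : Fin n, i ≠ k ∧ Irrational (a i / a k)) :
    Filter.Tendsto
      (fun z : ℝ => PascalPyramid.simplexIntegral a z / PascalPyramid.latticeSum a z)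
      Filter.atTop (nhds 1) := by
  obtain ⟨i, k, -, hik⟩ := hirr
  have h1 := PascalPyramid.tendsto_exp_neg_mul_simplexIntegral ha hsum hik
  have h2 := PascalPyramid.tendsto_exp_neg_mul_latticeSum ha hsum hik
  have h3 : 0 < ∑ j, Real.exp (-a j) * a j :=
    Finset.sum_pos (fun j _ => mul_pos (Real.exp_pos _) (ha j)) ⟨i, Finset.mem_univ i⟩
  have h4 := h1.div h2 (one_div_pos.mpr h3).ne'
  rw [div_self (one_div_pos.mpr h3).ne'] at h4
  refine h4.congr fun z => ?_
  simp only [Pi.div_apply]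
  exact mul_div_mul_left _ _ (Real.exp_pos _).ne'
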